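/- Let $n\ge 2$, let $\mathbb K=\mathbb R$ or $\mathbb C$, and let $x,y$ be independent variables in $\mathbb K$. All functions are $\mathbb C$-valued and $C^\infty$ over $\mathbb K$ (holomorphic if $\mathbb K=\mathbb C$). Put $$\Theta=\begin{pmatrix}0&I_n&0\\ I_n&0&0\\ 0&0&1\end{pmatrix},\qquad B(v,w)=v\,\Theta\,w^T\quad(v,w\in\mathbb C^{2n+1}).$$ Call a vector $F=(f_0,\dots,f_{2n})$ of functions on an open set $X\subseteq\mathbb K$ a $B_n$-vector on $X$ if, on $X$, $$B(F^{(i)},F^{(i)})=0\quad(0\le i\le n-1),\qquad B(F^{(n)},F^{(n)})=1 .\qquad(*)$$ For $F=F(x)$ and $G=G(y)$ put $\tau_i(x,y)=\det\Big(\sum_{m=0}^{2n}f_m^{(j)}(x)\,g_m^{(k)}(y)\Big)_{j,k=0}^{i-1}$. Let $(a_{ij})$ be the Cartan matrix of $B_n$: $a_{ii}=2$, $a_{n-1,n}=-2$, all other $a_{i,i\pm1}=-1$, and $a_{ij}=0$ for $|i-j|\ge2$. (1) Let $X,Y\subseteq\mathbb K$ be open and connected, and let $F$ on $X$ and $G$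 on $Y$ be $B_n$-vectors. Then there is a sign $\varepsilon\in\{1,-1\}$, depending only on $F$ and $G$, such that on every open $S\subseteq X\times Y$ and for every choice of continuous branches of $\log\tau_1,\dots,\log\tau_n$ on $S$, the functions $$u_i=-\log\tau_i\ (1\le i\le n-1),\qquad u_n=-\tfrac12\log\tau_n$$ are $C^\infty$ and satisfy on $S$ the $B_n$ Toda system with coefficient $\mp\frac12$ in the last equation: $$u_{i,xy}=-\exp\Big(\sum_{j=1}^n a_{ij}u_j\Big)\ (1\le i\le n-1),\qquad u_{n,xy}=-\frac{\varepsilon}{2}\exp\Big(\sum_{j=1}^n a_{nj}u_j\Big).$$ (2) For functions $\phi_1,\dots,\phi_n$ on an open set containing $0$ and star-shaped about $0$, define iterated integrals by $\mathcal I(\varnothing)=1$ and $\mathcal I(a_1a_2\cdots a_k)(x)=\int_0^x\phi_{a_1}(t)\,\mathcal I(a_2\cdots a_k)(t)\,dt$ (along the segment from $0$ to $x$); for nowhere vanishing $\phi_i$ put $p=1/(\phi_1\cdots\phi_n)$ and let $L_\phi=(f_0,\dots,f_{2n})$ be Leznov's vector $$f_i=(-1)^{n-i}p\,\mathcal I(1,2,\dots,i)\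 (0\le i\le n-1),$$ $$f_i=p\,\mathcal I(1,2,\dots,n,n,n-1,\dots,i-n+1)\ (n\le i\le 2n-1),\qquad f_{2n}=p\,\mathcal I(1,2,\dots,n).$$ Then $L_\phi$ is the most general solution of $(*)$ in the following sense. (a) For every open $X\ni0$ star-shaped about $0$ and all nowhere vanishing functions $\phi_1,\dots,\phi_n$ on $X$, the vector $L_\phi$ is a $B_n$-vector on $X$. (b) If $F$ is a $B_n$-vector on an open $X\ni 0$, then there are a constant matrix $A\in O(2n+1,\mathbb C)=\{A: A^T\Theta A=\Theta\}$, an open $U\subseteq X$ containing $0$ and star-shaped about $0$, and nowhere vanishing functions $\phi_1,\dots,\phi_n$ on $U$ such that $F A=L_\phi$ on $U$. -/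

import Mathlib

noncomputable section

open scoped ContDiff

namespace BnToda

/-- The symmetric matrix `Θ` with block rows `(0, Iₙ, 0)`, `(Iₙ, 0, 0)`, `(0, 0, 1)`. -/
def Theta (n : ℕ) : Matrix (Fin (2 * n + 1)) (Fin (2 * n + 1)) ℂ :=
  Matrix.of fun i j =>
    if (i.val < n ∧ j.val = i.val + n) ∨ (j.val < n ∧ i.val = j.val + n) ∨
        (i.val = 2 * n ∧ j.val = 2 * n) then 1 else 0

/-- The bilinear form `B(v, w) = v Θ wᵀ`. -/
def B (n : ℕ) (v w : Fin (2 * n + 1) → ℂ) : ℂ :=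
  dotProduct v ((Theta n).mulVec w)

/-- The iterated derivative `F⁽ʲ⁾ = (f₀⁽ʲ⁾, …, fₘ₋₁⁽ʲ⁾)` of a vector `F = (f₀, …, fₘ₋₁)` of
functions, evaluated at `x`. -/
def D {𝕜 : Type*} [RCLike 𝕜] [NormedAlgebra 𝕜 ℂ] {m : ℕ} (F : Fin m → 𝕜 → ℂ) (j : ℕ) (x : 𝕜) :
    Fin m → ℂ :=
  fun k => iteratedDeriv j (F k) x

/-- `F` is a vector of `2n+1` smooth functions on `X` with `B(F⁽ⁱ⁾, F⁽ⁱ⁾) = 0` for `i < n` and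
`B(F⁽ⁿ⁾, F⁽ⁿ⁾) = 1` on `X`. -/
structure IsBVector {𝕜 : Type*} [RCLike 𝕜] [NormedAlgebra 𝕜 ℂ] (n : ℕ)
    (F : Fin (2 * n + 1) → 𝕜 → ℂ) (X : Set 𝕜) : Prop where
  smooth : ∀ k, ContDiffOn 𝕜 ∞ (F k) X
  null : ∀ i < n, ∀ x ∈ X, B n (D F i x) (D F i x) = 0
  unit : ∀ x ∈ X, B n (D F n x) (D F n x) = 1

/-- `τᵢ(x, y)`, the determinant of the `i × i` matrix with entries `F⁽ʲ⁾(x) · G⁽ᵏ⁾(y)`,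
`0 ≤ j, k ≤ i - 1`. -/
def tau {𝕜 : Type*} [RCLike 𝕜] [NormedAlgebra 𝕜 ℂ] {m : ℕ} (F G : Fin m → 𝕜 → ℂ) (i : ℕ)
    (p : 𝕜 × 𝕜) : ℂ :=
  (Matrix.of fun j k : Fin i => dotProduct (D F j p.1) (D G k p.2)).det

/-- `l` is a continuous branch of `log v` on `S`. -/
def IsLogBranch {Z : Type*} [TopologicalSpace Z] (v l : Z → ℂ) (S : Set Z) : Prop :=
  ContinuousOn l S ∧ ∀ p ∈ S, Complex.exp (l p) = v p

/-- The mixed partial derivative `∂_y ∂_x u`. -/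
def mixedDeriv {𝕜 : Type*} [RCLike 𝕜] [NormedAlgebra 𝕜 ℂ] (u : 𝕜 × 𝕜 → ℂ) (p : 𝕜 × 𝕜) : ℂ :=
  deriv (fun y => deriv (fun x => u (x, y)) p.1) p.2

/-- The functions `u₁, …, uₙ` (indexed from `0`) are smooth on `S` and solve the `Bₙ` Toda system
`u_{i,xy} = -cᵢ exp (∑ⱼ aᵢⱼ uⱼ)` there, where `(aᵢⱼ)` is the Cartan matrix of `Bₙ`, `cᵢ = 1` for
`i < n`, and `cₙ = c`. -/
structure IsTodaSolution {𝕜 : Type*} [RCLike 𝕜] [NormedAlgebra 𝕜 ℂ] (n : ℕ) (c : ℂ)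
    (u : Fin n → 𝕜 × 𝕜 → ℂ) (S : Set (𝕜 × 𝕜)) : Prop where
  smooth : ∀ i, ContDiffOn 𝕜 ∞ (u i) S
  eqn : ∀ i, ∀ p ∈ S, mixedDeriv (u i) p =
    -(if i.val + 1 = n then c else 1) *
      Complex.exp (∑ j, ((CartanMatrix.B n i j : ℤ) : ℂ) * u j p)

/-- `∫₀ˣ f`, the integral along the segment from `0` to `x`, parametrized by `t ↦ t x`,
`0 ≤ t ≤ 1`. -/
def primitive {𝕜 : Type*} [RCLike 𝕜] [NormedAlgebra 𝕜 ℂ] (f : 𝕜 → ℂ) (x : 𝕜) : ℂ :=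
  ∫ t in (0 : ℝ)..1, x • f (t • x)

/-- The iterated integral `I(a₁ ⋯ aₖ) = ∫₀ˣ φ_{a₁} I(a₂ ⋯ aₖ)`, with `I(∅) = 1`. -/
def iterInt {𝕜 : Type*} [RCLike 𝕜] [NormedAlgebra 𝕜 ℂ] (φ : ℕ → 𝕜 → ℂ) : List ℕ → 𝕜 → ℂ
  | [] => fun _ => 1
  | a :: s => primitive fun x => φ a x * iterInt φ s x

/-- The increasing sequence `1, 2, …, i` (empty for `i = 0`). -/
def up (i : ℕ) : List ℕ := List.range' 1 i

/-- The decreasing sequence `n, n - 1, …, k`. -/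
def down (n k : ℕ) : List ℕ := (List.range' k (n + 1 - k)).reverse

/-- Leznov's vector `(f₀, …, f₂ₙ)` built from `φ₁, …, φₙ`: with `p = 1 / (φ₁ ⋯ φₙ)`,
`fᵢ = (-1)ⁿ⁻ⁱ p I(1 → i)` for `i < n`, `fᵢ = p I(1 → n, n → i - n + 1)` for `n ≤ i < 2n`, and
`f₂ₙ = p I(1 → n)`. -/
def leznov {𝕜 : Type*} [RCLike 𝕜] [NormedAlgebra 𝕜 ℂ] (n : ℕ) (φ : ℕ → 𝕜 → ℂ) :
    Fin (2 * n + 1) → 𝕜 → ℂ :=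
  fun i x =>
    1 / (∏ k ∈ Finset.Icc 1 n, φ k x) *
      if i.val < n then (-1) ^ (n - i.val) * iterInt φ (up i.val) x
      else if i.val < 2 * n then iterInt φ (up n ++ down n (i.val - n + 1)) x
      else iterInt φ (up n) x

end BnToda

end

/-!
Differentiating the conditions on a `Bₙ`-vector `F` shows that the Gram matrix
`B(F⁽ⁱ⁾, F⁽ʲ⁾)` vanishes for `i + j < 2n` and has alternating entries `±1` for `i + j = 2n`
(`IsBVector.gram`). Each part of the theorem is a consequence of this antitriangularity.

*The Toda system.* The Desnanot–Jacobi identity gives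
`∂_y ∂_x log τᵢ = τᵢ₋₁ τᵢ₊₁ / τᵢ²` (`mixedDeriv_log_tau`), which are the first `n - 1` equations.
The last one amounts to `τₙ₊₁ = ε τₙ`. To see this, pair the matrix with columns
`G, …, G⁽ⁿ⁾, ΘF, …, ΘF⁽ⁿ⁻¹⁾` once with the derivatives of `F` and once with those of `G`: both
products are block triangular, with the diagonal blocks of `τₙ₊₁`, respectively `τₙ`, and a
triangular Gram matrix (`tau_succ_eq`). So `ε` is, up to sign, the product of the Wronskian
determinants of `F` and `G`; their squares are fixed by the Gram matrix and hence they are constant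
on preconnected sets.

*Leznov's vectors.* Ordered by the length of the word, the components of Leznov's vector are
`p · I(c₁ ⋯ cₘ)`, `0 ≤ m ≤ 2n`, for the palindrome `c = 1, …, n, n, …, 1`, and `B` becomes
`∑ₘ (-1)ⁿ⁺ᵐ vₘ w₂ₙ₋ₘ`. The vectors `vₖ = (I(cₖ₊₁ ⋯ cₘ))ₘ` satisfy `vₖ' = φ vₖ₊₁`, the palindrome
property makes their Gram matrix constant (`form_frame`), and `F⁽ᵏ⁾` is a triangular combination of
`v₀, …, vₖ` (`exists_triangular_combination`).

*Generality.* The Gram matrix `H` of the derivatives at `0` factors as `T J Tᵀ` with `T` lower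
triangular, `T` being a square root of the unitriangular matrix `HJ` that is a polynomial in it
(`exists_triangular_factor`). Therefore some orthogonal matrix makes the Wronskian matrix at `0`
lower triangular. Then dividing by the leading component and differentiating in turn produces the
frame `vₖ` and the letters `cₖ`, and orthogonality forces the letters to form a palindrome and fixes
the factor `p` (`IsBVector.exists_leznov`).
-/

noncomputable section

open scoped ContDiff Topology
open Set Filter

namespace BnToda

/-! ### Calculus on open subsets of `𝕜` -/

theorem isPreconnected_of_starConvex {𝕜 : Type*} [RCLike 𝕜] {X : Set 𝕜}
    (hX : StarConvex ℝ (0 : 𝕜) X) : IsPreconnected X :=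
  isPreconnected_of_forall 0 fun y hy =>
    ⟨segment ℝ 0 y, hX.segment_subset hy, left_mem_segment _ _ _, right_mem_segment _ _ _,
      (convex_segment _ _).isPreconnected⟩

theorem smul_mem_of_starConvex {𝕜 : Type*} [RCLike 𝕜] {X : Set 𝕜}
    (hX : StarConvex ℝ (0 : 𝕜) X) {x : 𝕜} (hx : x ∈ X) {t : ℝ} (ht : t ∈ Icc (0 : ℝ) 1) :
    t • x ∈ X :=
  hX.smul_mem hx ht.1 ht.2

section Calculus

variable {𝕜 : Type*} [RCLike 𝕜] [NormedAlgebra 𝕜 ℂ]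

/-- For `𝕜 = ℂ` the algebra map `𝕜 → ℂ` may be the identity or the conjugation. In every case it
is continuous, hence compatible with the actions of `ℝ`. -/
theorem isScalarTower_real : IsScalarTower ℝ 𝕜 ℂ := by
  refine ⟨fun r a z => ?_⟩
  let f : 𝕜 →+ ℂ := ⟨⟨fun a => a • z, zero_smul _ _⟩, fun a b => add_smul a b z⟩
  have hf : Continuous f := continuous_id.smul continuous_const
  exact map_real_smul f hf r a

theorem differentiableAt_of_contDiffOn {f : 𝕜 → ℂ} {X : Set 𝕜} (hX : IsOpen X)
    (hf : ContDiffOn 𝕜 ∞ f X) {x : 𝕜} (hx : x ∈ X) : DifferentiableAt 𝕜 f x :=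
  (hf.contDiffAt (hX.mem_nhds hx)).differentiableAt (by simp)

theorem contDiffOn_deriv {f : 𝕜 → ℂ} {X : Set 𝕜} (hX : IsOpen X)
    (hf : ContDiffOn 𝕜 ∞ f X) : ContDiffOn 𝕜 ∞ (deriv f) X :=
  ((contDiffOn_infty_iff_deriv_of_isOpen hX).1 hf).2

theorem contDiffOn_iteratedDeriv {f : 𝕜 → ℂ} {X : Set 𝕜} (hX : IsOpen X)
    (hf : ContDiffOn 𝕜 ∞ f X) (j : ℕ) : ContDiffOn 𝕜 ∞ (iteratedDeriv j f) X := by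
  induction j with
  | zero => simpa using hf
  | succ j ih => rw [iteratedDeriv_succ]; exact contDiffOn_deriv hX ih

theorem hasDerivAt_iteratedDeriv {f : 𝕜 → ℂ} {X : Set 𝕜} (hX : IsOpen X)
    (hf : ContDiffOn 𝕜 ∞ f X) (j : ℕ) {x : 𝕜} (hx : x ∈ X) :
    HasDerivAt (iteratedDeriv j f) (iteratedDeriv (j + 1) f x) x := by
  rw [iteratedDeriv_succ]
  exact (differentiableAt_of_contDiffOn hX (contDiffOn_iteratedDeriv hX hf j) hx).hasDerivAt

theorem contDiffOn_of_hasDerivAt {f g : 𝕜 → ℂ} {X : Set 𝕜} (hX : IsOpen X)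
    (hf : ∀ x ∈ X, HasDerivAt f (g x) x) (hg : ContDiffOn 𝕜 ∞ g X) : ContDiffOn 𝕜 ∞ f X :=
  (contDiffOn_infty_iff_deriv_of_isOpen hX).2
    ⟨fun x hx => (hf x hx).differentiableAt.differentiableWithinAt,
      hg.congr fun x hx => (hf x hx).deriv⟩

theorem hasDerivAt_primitive {X : Set 𝕜} (hX : IsOpen X) (hs : StarConvex ℝ (0 : 𝕜) X)
    {f : 𝕜 → ℂ} (hf : ContDiffOn 𝕜 ∞ f X) {x : 𝕜} (hx : x ∈ X) :
    HasDerivAt (primitive f) (f x) x := by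
  have := isScalarTower_real (𝕜 := 𝕜)
  have hI : uIoc (0 : ℝ) 1 ⊆ Icc 0 1 := by
    rw [uIoc_of_le zero_le_one]; exact Ioc_subset_Icc_self
  have hd : ∀ y ∈ X, HasDerivAt f (deriv f y) y := fun y hy =>
    (differentiableAt_of_contDiffOn hX hf hy).hasDerivAt
  have hcont : ∀ {g : 𝕜 → ℂ}, ContinuousOn g X → ∀ y ∈ X,
      ContinuousOn (fun t : ℝ => g (t • y)) (Icc 0 1) := fun {g} hg y hy =>
    hg.comp (by fun_prop) fun t ht => smul_mem_of_starConvex hs hy ht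
  have hfc := hf.continuousOn
  have hdc := (contDiffOn_deriv hX hf).continuousOn
  obtain ⟨δ, hδ, hball⟩ := Metric.nhds_basis_closedBall.mem_iff.1 (hX.mem_nhds hx)
  let F' : 𝕜 → ℝ → ℂ := fun y t => f (t • y) + t • (y • deriv f (t • y))
  have hF'c : ContinuousOn (fun q : 𝕜 × ℝ => F' q.1 q.2) (X ×ˢ Icc (0 : ℝ) 1) := by
    have hm : MapsTo (fun q : 𝕜 × ℝ => q.2 • q.1) (X ×ˢ Icc (0 : ℝ) 1) X :=
      fun q hq => smul_mem_of_starConvex hs hq.1 hq.2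
    have hc : ContinuousOn (fun q : 𝕜 × ℝ => q.2 • q.1) (X ×ˢ Icc (0 : ℝ) 1) := by fun_prop
    exact (hfc.comp hc hm).add
      (continuousOn_snd.smul (continuousOn_fst.smul (hdc.comp hc hm)))
  obtain ⟨C, hC⟩ := ((isCompact_closedBall x δ).prod (isCompact_Icc (a := (0 : ℝ)) (b := 1))
    ).exists_bound_of_continuousOn (hF'c.mono (prod_mono hball Subset.rfl))
  have key := (intervalIntegral.hasDerivAt_integral_of_dominated_loc_of_deriv_le (𝕜 := 𝕜)
    (μ := MeasureTheory.volume) (a := 0) (b := 1) (F := fun y (t : ℝ) => y • f (t • y)) (F' := F')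
    (x₀ := x) (bound := fun _ => C) (Metric.closedBall_mem_nhds x hδ) ?_ ?_ ?_ ?_ (by simp) ?_).2
  · -- the derivative under the integral sign is the `t`-derivative of `t f(tx)`
    have hder : ∀ t ∈ uIcc (0 : ℝ) 1, HasDerivAt (fun t : ℝ => t • f (t • x)) (F' x t) t := by
      intro t ht
      rw [uIcc_of_le zero_le_one] at ht
      have h1 := ((hd _ (smul_mem_of_starConvex hs hx ht)).hasFDerivAt.restrictScalars ℝ
        ).comp_hasDerivAt t ((hasDerivAt_id t).smul_const x)
      have h2 := (hasDerivAt_id t).smul h1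
      exact h2.congr_deriv (by simp [F', add_comm])
    have hint : IntervalIntegrable (F' x) MeasureTheory.volume 0 1 := by
      refine ContinuousOn.intervalIntegrable ?_
      rw [uIcc_of_le zero_le_one]
      exact hF'c.comp (f := fun t : ℝ => (x, t)) (by fun_prop) fun t ht => ⟨hx, ht⟩
    rw [intervalIntegral.integral_eq_sub_of_hasDerivAt hder hint] at key
    exact key.congr_deriv (by simp)
  · filter_upwards [hX.mem_nhds hx] with y hy
    exact (((hcont hfc y hy).const_smul y).mono hI).aestronglyMeasurable measurableSet_uIoc
  · refine ContinuousOn.intervalIntegrable ?_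
    rw [uIcc_of_le zero_le_one]
    exact (hcont hfc x hx).const_smul x
  · refine ContinuousOn.aestronglyMeasurable ?_ measurableSet_uIoc
    exact hF'c.comp (f := fun t : ℝ => (x, t)) (by fun_prop) fun t ht => ⟨hx, hI ht⟩
  · exact Eventually.of_forall fun t ht y hy => hC (y, t) ⟨hy, hI ht⟩
  · refine Eventually.of_forall fun t ht y hy => ?_
    have h1 : HasDerivAt (fun y : 𝕜 => t • y) (t • (1 : 𝕜)) y := (hasDerivAt_id y).const_smul t
    have h2 := (hd _ (smul_mem_of_starConvex hs (hball hy) (hI ht))).scomp y h1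
    have h3 := (hasDerivAt_id y).smul h2
    refine h3.congr_deriv ?_
    simp only [F', Function.comp, id, one_smul, smul_assoc]
    rw [add_comm, smul_comm]

theorem primitive_zero (f : 𝕜 → ℂ) : primitive f 0 = 0 := by
  simp [primitive]

theorem contDiffOn_primitive {X : Set 𝕜} (hX : IsOpen X) (hs : StarConvex ℝ (0 : 𝕜) X)
    {f : 𝕜 → ℂ} (hf : ContDiffOn 𝕜 ∞ f X) : ContDiffOn 𝕜 ∞ (primitive f) X :=
  contDiffOn_of_hasDerivAt hX (fun _ hx => hasDerivAt_primitive hX hs hf hx) hf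

/-- A function with vanishing derivative on a preconnected open set is constant there. -/
theorem eq_of_hasDerivAt_zero {X : Set 𝕜} (hX : IsOpen X) (hc : IsPreconnected X) {f : 𝕜 → ℂ}
    (hf : ∀ x ∈ X, HasDerivAt f 0 x) {x y : 𝕜} (hx : x ∈ X) (hy : y ∈ X) : f x = f y :=
  hX.eqOn_of_deriv_eq hc (fun z hz => (hf z hz).differentiableAt.differentiableWithinAt)
    (differentiableOn_const (f y)) (fun z hz => by simp [(hf z hz).deriv]) hy rfl hx

theorem eq_primitive {X : Set 𝕜} (hX : IsOpen X) (hs : StarConvex ℝ (0 : 𝕜) X)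
    (h0 : (0 : 𝕜) ∈ X) {f g : 𝕜 → ℂ} (hg : ContDiffOn 𝕜 ∞ g X)
    (hf : ∀ x ∈ X, HasDerivAt f (g x) x) (hf0 : f 0 = 0) {x : 𝕜} (hx : x ∈ X) :
    f x = primitive g x := by
  refine hX.eqOn_of_deriv_eq (isPreconnected_of_starConvex hs)
    (fun z hz => (hf z hz).differentiableAt.differentiableWithinAt)
    (fun z hz => (hasDerivAt_primitive hX hs hg hz).differentiableAt.differentiableWithinAt)
    (fun z hz => ?_) h0 (by rw [hf0, primitive_zero]) hx
  rw [(hf z hz).deriv, (hasDerivAt_primitive hX hs hg hz).deriv]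

end Calculus

/-! ### The bilinear form `B` -/

section Form

/-- The involution of the index set with `Θ eᵢ = e_{σ i}`. -/
def thetaPerm (n : ℕ) (i : Fin (2 * n + 1)) : Fin (2 * n + 1) :=
  if h : i.val < n then ⟨i.val + n, by omega⟩
  else if i.val < 2 * n then ⟨i.val - n, by omega⟩ else i

theorem thetaPerm_val (n : ℕ) (i : Fin (2 * n + 1)) : (thetaPerm n i).val =
    if i.val < n then i.val + n else if i.val < 2 * n then i.val - n else i.val := by
  unfold thetaPerm
  split_ifs <;> rfl

theorem thetaPerm_thetaPerm (n : ℕ) (i : Fin (2 * n + 1)) : thetaPerm n (thetaPerm n i) = i := by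
  apply Fin.ext
  have := i.isLt
  rw [thetaPerm_val, thetaPerm_val]
  split_ifs <;> omega

theorem Theta_apply (n : ℕ) (i j : Fin (2 * n + 1)) :
    Theta n i j = if j = thetaPerm n i then 1 else 0 := by
  have hi := i.isLt
  have hj := j.isLt
  rw [Theta, Matrix.of_apply]
  refine if_congr ?_ rfl rfl
  rw [Fin.ext_iff, thetaPerm_val]
  split_ifs <;> omega

theorem Theta_mul_self (n : ℕ) : Theta n * Theta n = 1 := by
  ext i j
  simp only [Matrix.mul_apply, Theta_apply, ite_mul, one_mul, zero_mul, Finset.sum_ite_eq',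
    Finset.mem_univ, if_true, thetaPerm_thetaPerm, Matrix.one_apply, eq_comm]

theorem Theta_transpose (n : ℕ) : (Theta n).transpose = Theta n := by
  ext i j
  rw [Matrix.transpose_apply, Theta_apply, Theta_apply]
  refine if_congr ⟨fun h => ?_, fun h => ?_⟩ rfl rfl <;> rw [h, thetaPerm_thetaPerm]

theorem neg_one_pow_add_sub {n i : ℕ} (h : i ≤ 2 * n) :
    (-1 : ℂ) ^ (n + (2 * n - i)) = (-1) ^ (n + i) := by
  rcases Nat.even_or_odd (n + i) with h | h
  · rw [h.neg_one_pow, Even.neg_one_pow]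
    rw [Nat.even_iff] at *; omega
  · rw [h.neg_one_pow, Odd.neg_one_pow]
    rw [Nat.odd_iff] at *; omega

theorem B_eq_sum (n : ℕ) (v w : Fin (2 * n + 1) → ℂ) :
    B n v w = ∑ i, v i * w (thetaPerm n i) := by
  simp only [B, dotProduct, Matrix.mulVec, Theta_apply, ite_mul, one_mul, zero_mul,
    Finset.sum_ite_eq', Finset.mem_univ, if_true]

theorem B_comm (n : ℕ) (v w : Fin (2 * n + 1) → ℂ) : B n v w = B n w v := by
  rw [B, B, Matrix.dotProduct_mulVec, ← Matrix.mulVec_transpose, Theta_transpose, dotProduct_comm]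

/-- The coordinate of Leznov's vector given by the iterated integral over the first `m` letters of
`1, 2, …, n, n, …, 2, 1`. -/
def wordIndex (n m : ℕ) : Fin (2 * n + 1) :=
  ⟨if m < n then m else 3 * n - m, by split_ifs <;> omega⟩

/-- The sign which that coordinate carries in Leznov's vector. -/
def wordSign (n m : ℕ) : ℂ := if m < n then (-1) ^ (n - m) else 1

/-- The coordinates of `f` in the order of `wordIndex`, freed from their signs. -/
def word (n : ℕ) (f : Fin (2 * n + 1) → ℂ) (m : ℕ) : ℂ := wordSign n m * f (wordIndex n m)

/-- The form `B` in the coordinates `word`: `∑ₘ (-1)ⁿ⁺ᵐ vₘ w₂ₙ₋ₘ`. -/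
def form (n : ℕ) (v w : ℕ → ℂ) : ℂ :=
  ∑ m ∈ Finset.range (2 * n + 1), (-1) ^ (n + m) * (v m * w (2 * n - m))

theorem wordSign_mul_self (n m : ℕ) : wordSign n m * wordSign n m = 1 := by
  unfold wordSign
  split_ifs
  · rw [← mul_pow]; simp
  · simp

theorem wordIndex_wordIndex (n : ℕ) (i : Fin (2 * n + 1)) :
    wordIndex n (wordIndex n i).val = i := by
  have := i.isLt
  apply Fin.ext
  simp only [wordIndex]
  split_ifs <;> omega

theorem wordSign_wordIndex (n : ℕ) (i : Fin (2 * n + 1)) :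
    wordSign n (wordIndex n i).val = wordSign n i.val := by
  have := i.isLt
  unfold wordSign wordIndex
  by_cases h : i.val < n
  · simp [h]
  · have h' : ¬ 3 * n - i.val < n := by omega
    simp [h, h']

theorem thetaPerm_wordIndex {n m : ℕ} (hm : m ≤ 2 * n) :
    thetaPerm n (wordIndex n m) = wordIndex n (2 * n - m) := by
  apply Fin.ext
  rw [thetaPerm_val]
  simp only [wordIndex]
  split_ifs <;> omega

theorem wordSign_mul_wordSign {n m : ℕ} (hm : m ≤ 2 * n) :
    wordSign n m * wordSign n (2 * n - m) = (-1) ^ (n + m) := by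
  unfold wordSign
  split_ifs with h1 h2 h2
  · omega
  · rw [mul_one, show n + m = (n - m) + 2 * m by omega, pow_add, pow_mul]; simp
  · rw [one_mul, show n + m = (n - (2 * n - m)) + 2 * n by omega, pow_add, pow_mul]; simp
  · rw [show n + m = 2 * n by omega, pow_mul]; simp

/-- `wordIndex` as a permutation of the index set. -/
def wordEquiv (n : ℕ) : Fin (2 * n + 1) ≃ Fin (2 * n + 1) :=
  Function.Involutive.toPerm (fun i => wordIndex n i.val) (wordIndex_wordIndex n)

theorem B_eq_form (n : ℕ) (v w : Fin (2 * n + 1) → ℂ) :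
    B n v w = form n (word n v) (word n w) := by
  rw [B_eq_sum, form, Finset.sum_range, ← (wordEquiv n).sum_comp]
  refine Finset.sum_congr rfl fun m _ => ?_
  have hm : m.val ≤ 2 * n := by omega
  change v (wordIndex n m) * w (thetaPerm n (wordIndex n m)) = _
  rw [thetaPerm_wordIndex hm, word, word, ← wordSign_mul_wordSign hm]
  linear_combination (-v (wordIndex n m) * w (wordIndex n (2 * n - m)) *
    (wordSign n (2 * n - m) * wordSign n (2 * n - m))) * wordSign_mul_self n m -
      v (wordIndex n m) * w (wordIndex n (2 * n - m)) * wordSign_mul_self n (2 * n - m)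

theorem form_eq_zero {n : ℕ} {v w : ℕ → ℂ} (h : ∀ m ≤ 2 * n, v m = 0 ∨ w (2 * n - m) = 0) :
    form n v w = 0 :=
  Finset.sum_eq_zero fun m hm => by
    rcases h m (by have := Finset.mem_range.1 hm; omega) with h | h <;> simp [h]

/-- If the first `k` coordinates of `v` and the first `2n - k` coordinates of `w` vanish, a single
term of `form n v w` is left. -/
theorem form_of_triangular {n k l : ℕ} (hkl : k + l = 2 * n) {v w : ℕ → ℂ}
    (hv : ∀ m < k, v m = 0) (hw : ∀ m < l, w m = 0) :
    form n v w = (-1) ^ (n + k) * (v k * w l) := by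
  rw [form, Finset.sum_eq_single k]
  · rw [show 2 * n - k = l by omega]
  · intro m hm hmk
    have := Finset.mem_range.1 hm
    rcases lt_or_gt_of_ne hmk with h | h
    · simp [hv m h]
    · simp [hw (2 * n - m) (by omega)]
  · intro h
    exact absurd (Finset.mem_range.2 (by omega)) h

theorem form_sum_sum (n : ℕ) (s t : Finset ℕ) (α β : ℕ → ℂ) (v w : ℕ → ℕ → ℂ) :
    form n (fun m => ∑ a ∈ s, α a * v a m) (fun m => ∑ b ∈ t, β b * w b m) =
      ∑ a ∈ s, ∑ b ∈ t, α a * β b * form n (v a) (w b) := by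
  simp only [form, Finset.sum_mul_sum]
  simp only [Finset.mul_sum]
  rw [Finset.sum_comm]
  refine Finset.sum_congr rfl fun a _ => ?_
  rw [Finset.sum_comm]
  refine Finset.sum_congr rfl fun b _ => Finset.sum_congr rfl fun m _ => ?_
  ring

/-- Triangular combinations of vectors with antitriangular Gram matrix have antitriangular Gram
matrix, and the antidiagonal is multiplied by the diagonal coefficients. -/
theorem form_combination {n k l : ℕ} (hkl : k + l ≤ 2 * n) {α β : ℕ → ℂ} {v : ℕ → ℕ → ℂ}
    (hv : ∀ a b, a + b < 2 * n → form n (v a) (v b) = 0) :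
    form n (fun m => ∑ a ∈ Finset.range (k + 1), α a * v a m)
      (fun m => ∑ b ∈ Finset.range (l + 1), β b * v b m) =
        α k * β l * form n (v k) (v l) := by
  rw [form_sum_sum, Finset.sum_eq_single k, Finset.sum_eq_single l]
  · intro b hb hne
    have := Finset.mem_range.1 hb
    rw [hv k b (by omega), mul_zero]
  · simp
  · intro a ha hne
    have := Finset.mem_range.1 ha
    refine Finset.sum_eq_zero fun b hb => ?_
    have := Finset.mem_range.1 hb
    rw [hv a b (by omega), mul_zero]
  · simp

variable {𝕜 : Type*} [RCLike 𝕜] [NormedAlgebra 𝕜 ℂ]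

theorem hasDerivAt_form (n : ℕ) {v w : ℕ → 𝕜 → ℂ} {v' w' : ℕ → ℂ} {x : 𝕜}
    (hv : ∀ m ≤ 2 * n, HasDerivAt (v m) (v' m) x) (hw : ∀ m ≤ 2 * n, HasDerivAt (w m) (w' m) x) :
    HasDerivAt (fun x => form n (fun m => v m x) (fun m => w m x))
      (form n v' (fun m => w m x) + form n (fun m => v m x) w') x := by
  simp only [form, ← Finset.sum_add_distrib]
  refine HasDerivAt.fun_sum fun m hm => ?_
  have hm' : m ≤ 2 * n := by have := Finset.mem_range.1 hm; omega
  refine (((hv m hm').mul (hw (2 * n - m) (by omega))).const_mul ((-1 : ℂ) ^ (n + m))).congr_deriv ?_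
  ring

theorem hasDerivAt_D {m : ℕ} {F : Fin m → 𝕜 → ℂ} {X : Set 𝕜} (hX : IsOpen X)
    (hF : ∀ k, ContDiffOn 𝕜 ∞ (F k) X) (j : ℕ) (k : Fin m) {x : 𝕜} (hx : x ∈ X) :
    HasDerivAt (fun x => D F j x k) (D F (j + 1) x k) x :=
  hasDerivAt_iteratedDeriv hX (hF k) j hx

theorem hasDerivAt_B {n : ℕ} {F G : Fin (2 * n + 1) → 𝕜 → ℂ} {X : Set 𝕜} (hX : IsOpen X)
    (hF : ∀ k, ContDiffOn 𝕜 ∞ (F k) X) (hG : ∀ k, ContDiffOn 𝕜 ∞ (G k) X) (i j : ℕ)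
    {x : 𝕜} (hx : x ∈ X) :
    HasDerivAt (fun x => B n (D F i x) (D G j x))
      (B n (D F (i + 1) x) (D G j x) + B n (D F i x) (D G (j + 1) x)) x := by
  simp only [B_eq_sum, ← Finset.sum_add_distrib]
  exact HasDerivAt.fun_sum fun m _ => (hasDerivAt_D hX hF i m hx).mul (hasDerivAt_D hX hG j _ hx)

/-- If a symmetric family satisfies the Leibniz rule `b i j' = b (i+1) j + b i (j+1)`, vanishing on
one antidiagonal makes it alternate along the next one. -/
theorem gram_alternates {X : Set 𝕜} (hX : IsOpen X) {b : ℕ → ℕ → 𝕜 → ℂ}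
    (hd : ∀ i j, ∀ x ∈ X, HasDerivAt (b i j) (b (i + 1) j x + b i (j + 1) x) x) {s : ℕ}
    (hs : ∀ i j, i + j = s → ∀ x ∈ X, b i j x = 0) {x : 𝕜} (hx : x ∈ X) (i : ℕ) :
    ∀ j, i + j = s + 1 → b i j x = (-1) ^ i * b 0 (s + 1) x := by
  induction i with
  | zero => intro j hj; rw [show j = s + 1 by omega]; simp
  | succ i ih =>
    intro j hj
    have h1 := hd i j x hx
    have h2 : HasDerivAt (b i j) 0 x :=
      (hasDerivAt_const x (0 : ℂ)).congr_of_eventuallyEq <| by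
        filter_upwards [hX.mem_nhds hx] with y hy using hs i j (by omega) y hy
    have h3 := h1.unique h2
    rw [ih (j + 1) (by omega)] at h3
    rw [pow_succ]
    linear_combination h3

/-- The Gram matrix of the derivatives is antitriangular, with alternating signs `±1` on the
antidiagonal. -/
theorem gram_antitriangular {X : Set 𝕜} (hX : IsOpen X) {n : ℕ} {b : ℕ → ℕ → 𝕜 → ℂ}
    (hd : ∀ i j, ∀ x ∈ X, HasDerivAt (b i j) (b (i + 1) j x + b i (j + 1) x) x)
    (hsymm : ∀ i j x, b i j x = b j i x) (h0 : ∀ i < n, ∀ x ∈ X, b i i x = 0)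
    (h1 : ∀ x ∈ X, b n n x = 1) :
    (∀ i j, i + j < 2 * n → ∀ x ∈ X, b i j x = 0) ∧
      ∀ i j, i + j = 2 * n → ∀ x ∈ X, b i j x = (-1) ^ (n + i) := by
  have key : ∀ s < 2 * n, ∀ i j, i + j = s → ∀ x ∈ X, b i j x = 0 := by
    intro s
    induction s with
    | zero =>
      intro hs i j hij x hx
      rw [show i = 0 by omega, show j = 0 by omega]
      exact h0 0 (by omega) x hx
    | succ s ih =>
      intro hs i j hij x hx
      have alt := gram_alternates hX hd (ih (by omega)) hx
      suffices hz : b 0 (s + 1) x = 0 by rw [alt i j hij, hz, mul_zero]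
      rcases Nat.even_or_odd' (s + 1) with ⟨k, hk | hk⟩
      · have h := alt k k (by omega)
        rw [h0 k (by omega) x hx] at h
        simpa using h.symm
      · have h := alt k (k + 1) (by omega)
        have h' := alt (k + 1) k (by omega)
        rw [hsymm, h, pow_succ] at h'
        have : (-1 : ℂ) ^ k * b 0 (s + 1) x = 0 := by linear_combination h' / 2
        simpa using this
  refine ⟨fun i j hij => key _ hij i j rfl, fun i j hij x hx => ?_⟩
  rcases Nat.eq_zero_or_pos n with rfl | hn
  · rw [show i = 0 by omega, show j = 0 by omega]
    simpa using h1 x hx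
  · have alt := gram_alternates hX hd (s := 2 * n - 1) (key _ (by omega)) hx
    have h := alt n n (by omega)
    rw [h1 x hx] at h
    rw [alt i j (by omega), pow_add]
    have hsq : (-1 : ℂ) ^ n * (-1) ^ n = 1 := by rw [← mul_pow]; simp
    linear_combination (-1) ^ n * (-1) ^ i * (-h) - (-1) ^ i * b 0 (2 * n - 1 + 1) x * hsq

theorem IsBVector.gram {n : ℕ} {F : Fin (2 * n + 1) → 𝕜 → ℂ} {X : Set 𝕜} (hX : IsOpen X)
    (hF : IsBVector n F X) :
    (∀ i j, i + j < 2 * n → ∀ x ∈ X, B n (D F i x) (D F j x) = 0) ∧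
      ∀ i j, i + j = 2 * n → ∀ x ∈ X, B n (D F i x) (D F j x) = (-1) ^ (n + i) :=
  gram_antitriangular (b := fun i j x => B n (D F i x) (D F j x)) hX
    (fun i j _ hx => hasDerivAt_B hX hF.smooth hF.smooth i j hx)
    (fun _ _ _ => B_comm _ _ _) hF.null hF.unit

end Form

/-! ### Bordered determinants and their derivatives -/

section Minors

/-- The sequence `0, 1, …, N - 1, r`. -/
def bordered (N r : ℕ) (i : Fin (N + 1)) : ℕ := if i.val < N then i.val else r

theorem bordered_self (N : ℕ) : bordered N N = fun i : Fin (N + 1) => i.val := by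
  funext i
  have := i.isLt
  unfold bordered
  split_ifs <;> omega

/-- The bordered minors of an invertible block `A` are `det A` times the entries of a Schur
complement. -/
theorem det_bordered {N : ℕ} (m : ℕ → ℕ → ℂ) (A : Matrix (Fin N) (Fin N) ℂ) [Invertible A]
    (hA : ∀ i j, A i j = m i j) (r c : ℕ) :
    (Matrix.of fun i j : Fin (N + 1) => m (bordered N r i) (bordered N c j)).det =
      A.det * (m r c - dotProduct (fun j : Fin N => m r j) ((⅟A).mulVec fun i : Fin N => m i c)) := by
  rw [← Matrix.det_submatrix_equiv_self (finSumFinEquiv (m := N) (n := 1))]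
  have hb : (Matrix.of fun i j : Fin (N + 1) => m (bordered N r i) (bordered N c j)).submatrix
      (finSumFinEquiv (m := N) (n := 1)) (finSumFinEquiv (m := N) (n := 1)) =
      Matrix.fromBlocks A (Matrix.of fun i _ => m i c) (Matrix.of fun _ j => m r j)
        (Matrix.of fun _ _ => m r c) := by
    ext i j
    rcases i with i | i <;> rcases j with j | j <;> simp [bordered, hA]
  rw [hb, Matrix.det_fromBlocks₁₁, Matrix.det_fin_one, Matrix.mul_assoc]
  rfl

/-- The Desnanot–Jacobi identity. -/
theorem det_mul_det_eq_bordered (m : ℕ → ℕ → ℂ) (N : ℕ)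
    (h : (Matrix.of fun i j : Fin N => m i j).det ≠ 0) :
    (Matrix.of fun i j : Fin N => m i j).det * (Matrix.of fun i j : Fin (N + 2) => m i j).det =
      (Matrix.of fun i j : Fin (N + 1) => m i j).det *
        (Matrix.of fun i j => m (bordered N (N + 1) i) (bordered N (N + 1) j)).det -
      (Matrix.of fun i j : Fin (N + 1) => m (bordered N (N + 1) i) j).det *
        (Matrix.of fun i j : Fin (N + 1) => m i (bordered N (N + 1) j)).det := by
  set A : Matrix (Fin N) (Fin N) ℂ := Matrix.of fun i j : Fin N => m i j with hA
  let _ : Invertible A := A.invertibleOfIsUnitDet (isUnit_iff_ne_zero.2 h)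
  have hb := det_bordered m A (fun _ _ => rfl)
  have h00 := hb N N
  have h01 := hb N (N + 1)
  have h10 := hb (N + 1) N
  rw [bordered_self] at h00 h01 h10
  have h2 : (Matrix.of fun i j : Fin (N + 2) => m i j).submatrix
      (finSumFinEquiv (m := N) (n := 2)) (finSumFinEquiv (m := N) (n := 2)) =
      Matrix.fromBlocks A (Matrix.of fun (i : Fin N) (j : Fin 2) => m i (N + j))
        (Matrix.of fun (i : Fin 2) (j : Fin N) => m (N + i) j)
        (Matrix.of fun i j : Fin 2 => m (N + i) (N + j)) := by
    ext i j
    rcases i with i | i <;> rcases j with j | j <;> simp [A]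
  rw [h00, h01, h10, hb, ← Matrix.det_submatrix_equiv_self (finSumFinEquiv (m := N) (n := 2))
    (Matrix.of fun i j : Fin (N + 2) => m i j), h2, Matrix.det_fromBlocks₁₁, Matrix.det_fin_two,
    Matrix.mul_assoc]
  simp only [Matrix.sub_apply]
  have he : ∀ a b : Fin 2, ((Matrix.of fun (i : Fin 2) (j : Fin N) => m (N + i) j) *
      (⅟A * Matrix.of fun (i : Fin N) (j : Fin 2) => m i (N + j))) a b =
      dotProduct (fun j : Fin N => m (N + a) j)
        ((⅟A).mulVec fun i : Fin N => m i (N + b)) := fun _ _ => rfl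
  simp only [he, Matrix.of_apply, Fin.val_zero, Fin.val_one, add_zero]
  ring

variable {𝕜 : Type*} [RCLike 𝕜] [NormedAlgebra 𝕜 ℂ]

theorem hasDerivAt_det {N : ℕ} {M : Fin N → Fin N → 𝕜 → ℂ} {M' : Fin N → Fin N → ℂ} {x : 𝕜}
    (h : ∀ i j, HasDerivAt (M i j) (M' i j) x) :
    HasDerivAt (fun x => (Matrix.of fun i j => M i j x).det)
      (∑ i, ((Matrix.of fun i j => M i j x).updateRow i (M' i)).det) x := by
  have hexp : ∀ A : Matrix (Fin N) (Fin N) ℂ,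
      A.det = ∑ σ : Equiv.Perm (Fin N), ((Equiv.Perm.sign σ : ℤ) : ℂ) * ∏ i, A i (σ i) := by
    intro A
    rw [← Matrix.det_transpose, Matrix.det_apply']
    rfl
  simp only [hexp]
  rw [Finset.sum_comm]
  refine HasDerivAt.fun_sum fun σ _ => ?_
  rw [← Finset.mul_sum]
  refine HasDerivAt.const_mul _ ?_
  refine (HasDerivAt.fun_finsetProd fun i (_ : i ∈ Finset.univ) => h i (σ i)).congr_deriv ?_
  refine Finset.sum_congr rfl fun i _ => ?_
  rw [← Finset.prod_erase_mul _ _ (Finset.mem_univ i), Matrix.updateRow_self, smul_eq_mul]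
  congr 1
  refine Finset.prod_congr rfl fun j hj => ?_
  rw [Matrix.updateRow_ne (Finset.ne_of_mem_erase hj)]
  rfl

/-- The determinant with entries `F⁽ʳʲ⁾(x) · G⁽ᶜᵏ⁾(y)`. -/
def minor {m N : ℕ} (F G : Fin m → 𝕜 → ℂ) (r c : Fin N → ℕ) (x y : 𝕜) : ℂ :=
  (Matrix.of fun j k => dotProduct (D F (r j) x) (D G (c k) y)).det

theorem minor_swap {m N : ℕ} (F G : Fin m → 𝕜 → ℂ) (r c : Fin N → ℕ) (x y : 𝕜) :
    minor F G r c x y = minor G F c r y x := by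
  rw [minor, ← Matrix.det_transpose]
  refine congrArg Matrix.det (Matrix.ext fun i j => ?_)
  exact dotProduct_comm (D F (r j) x) (D G (c i) y)

theorem tau_succ {m : ℕ} (F G : Fin m → 𝕜 → ℂ) (N : ℕ) (x y : 𝕜) :
    tau F G (N + 1) (x, y) = minor F G (bordered N N) (bordered N N) x y := by
  rw [bordered_self]; rfl

/-- Only the last row of a Wronskian-type determinant contributes to its derivative: each other
row becomes equal to the next one. -/
theorem hasDerivAt_minor_left {m N : ℕ} {F : Fin m → 𝕜 → ℂ} {X : Set 𝕜} (hX : IsOpen X)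
    (hF : ∀ k, ContDiffOn 𝕜 ∞ (F k) X) (G : Fin m → 𝕜 → ℂ) (c : Fin (N + 1) → ℕ) {x : 𝕜}
    (hx : x ∈ X) (y : 𝕜) :
    HasDerivAt (fun x => minor F G (bordered N N) c x y)
      (minor F G (bordered N (N + 1)) c x y) x := by
  have hd := hasDerivAt_det (x := x)
    (M := fun j k x => dotProduct (D F (bordered N N j) x) (D G (c k) y))
    (M' := fun j k => dotProduct (D F (bordered N N j + 1) x) (D G (c k) y))
    (fun j k => HasDerivAt.fun_sum fun a _ => (hasDerivAt_D hX hF _ a hx).mul_const _)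
  refine hd.congr_deriv ?_
  rw [Finset.sum_eq_single (Fin.last N)]
  · rw [minor]
    congr 1
    ext j k
    rw [Matrix.updateRow_apply]
    split_ifs with hj
    · simp [hj, bordered]
    · have : j.val < N := by
        have := j.isLt
        have : j.val ≠ N := fun h => hj (Fin.ext h)
        omega
      simp [bordered, this]
  · intro j _ hj
    have hjN : j.val < N := by
      have := j.isLt
      have : j.val ≠ N := fun h => hj (Fin.ext h)
      omega
    have hne : j ≠ ⟨j.val + 1, by omega⟩ := fun h => by
      have := congrArg Fin.val h
      simp at this
    refine Matrix.det_zero_of_row_eq hne ?_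
    rw [Matrix.updateRow_self, Matrix.updateRow_ne hne.symm]
    funext k
    simp only [Matrix.of_apply, bordered_self]
  · simp

theorem hasDerivAt_minor_right {m N : ℕ} {G : Fin m → 𝕜 → ℂ} {Y : Set 𝕜} (hY : IsOpen Y)
    (hG : ∀ k, ContDiffOn 𝕜 ∞ (G k) Y) (F : Fin m → 𝕜 → ℂ) (r : Fin (N + 1) → ℕ) (x : 𝕜) {y : 𝕜}
    (hy : y ∈ Y) :
    HasDerivAt (fun y => minor F G r (bordered N N) x y)
      (minor F G r (bordered N (N + 1)) x y) y := by
  simp only [minor_swap F G]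
  exact hasDerivAt_minor_left hY hG F r hy x

theorem contDiffOn_tau {m : ℕ} {F G : Fin m → 𝕜 → ℂ} {X Y : Set 𝕜} (hX : IsOpen X) (hY : IsOpen Y)
    (hF : ∀ k, ContDiffOn 𝕜 ∞ (F k) X) (hG : ∀ k, ContDiffOn 𝕜 ∞ (G k) Y) (i : ℕ) :
    ContDiffOn 𝕜 ∞ (tau F G i) (X ×ˢ Y) := by
  have hexp : tau F G i = fun p => ∑ σ : Equiv.Perm (Fin i),
      ((Equiv.Perm.sign σ : ℤ) : ℂ) * ∏ j, ∑ a, D F (σ j).val p.1 a * D G j.val p.2 a := by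
    funext p
    rw [tau, Matrix.det_apply']
    rfl
  rw [hexp]
  refine ContDiffOn.sum fun σ _ => contDiffOn_const.mul (contDiffOn_prod fun j _ =>
    ContDiffOn.sum fun a _ => ContDiffOn.mul ?_ ?_)
  · exact (contDiffOn_iteratedDeriv hX (hF a) _).comp contDiffOn_fst fun p hp => hp.1
  · exact (contDiffOn_iteratedDeriv hY (hG a) _).comp contDiffOn_snd fun p hp => hp.2

theorem tau_mul_tau {m : ℕ} (F G : Fin m → 𝕜 → ℂ) (N : ℕ) {x y : 𝕜} (h : tau F G N (x, y) ≠ 0) :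
    tau F G N (x, y) * tau F G (N + 2) (x, y) =
      minor F G (bordered N N) (bordered N N) x y *
        minor F G (bordered N (N + 1)) (bordered N (N + 1)) x y -
      minor F G (bordered N (N + 1)) (bordered N N) x y *
        minor F G (bordered N N) (bordered N (N + 1)) x y := by
  have := det_mul_det_eq_bordered (fun j k => dotProduct (D F j x) (D G k y)) N h
  rw [bordered_self]
  exact this

end Minors

/-! ### The relation `τₙ₊₁ = ± τₙ` -/

section LastTau

variable {𝕜 : Type*} [RCLike 𝕜] [NormedAlgebra 𝕜 ℂ]

/-- The Wronskian matrix, with rows `F⁽⁰⁾(x), …, F⁽ᵐ⁻¹⁾(x)`. -/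
def wronskian {m : ℕ} (F : Fin m → 𝕜 → ℂ) (x : 𝕜) : Matrix (Fin m) (Fin m) ℂ :=
  Matrix.of fun j => D F j.val x

/-- The sum of two index sets of sizes `n + 1` and `n` as `0, …, n` and, in decreasing order,
`2n, …, n + 1`. -/
def splitEquiv (n : ℕ) : Fin (n + 1) ⊕ Fin n ≃ Fin (2 * n + 1) :=
  Equiv.ofBijective
    (Sum.elim (fun j => ⟨j.val, by omega⟩) (fun j => ⟨2 * n - j.val, by omega⟩)) <| by
    rw [Fintype.bijective_iff_injective_and_card]
    refine ⟨?_, by simp; omega⟩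
    rintro (i | i) (j | j) h <;>
      simp only [Sum.elim_inl, Sum.elim_inr, Fin.mk.injEq] at h <;>
      first
        | (congr 1; ext; omega)
        | omega

/-- The product of the first `k` antidiagonal signs `(-1)ⁿ⁺ⁱ`. -/
def signProd (n k : ℕ) : ℂ := ∏ i : Fin k, (-1) ^ (n + i.val)

theorem signProd_mul_self (n k : ℕ) : signProd n k * signProd n k = 1 := by
  rw [signProd, ← Finset.prod_mul_distrib]
  refine Finset.prod_eq_one fun i _ => ?_
  rw [← mul_pow]; simp

theorem signProd_succ_self (n : ℕ) : signProd n (n + 1) = signProd n n := by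
  rw [signProd, Fin.prod_univ_castSucc]
  simp only [Fin.val_last, Fin.val_castSucc]
  rw [← two_mul n, pow_mul]
  simp [signProd]

/-- An antitriangular matrix with its columns reversed has determinant the product of its
antidiagonal. -/
theorem det_antitriangular {n k : ℕ} {b : ℕ → ℕ → ℂ} (hk : k ≤ 2 * n + 1)
    (h0 : ∀ i j, i + j < 2 * n → b i j = 0) (h1 : ∀ i j, i + j = 2 * n → b i j = (-1) ^ (n + i)) :
    (Matrix.of fun i j : Fin k => b (2 * n - i.val) j.val).det = signProd n k := by
  rw [Matrix.det_of_isUpperTriangular]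
  · refine Finset.prod_congr rfl fun i _ => ?_
    have := i.isLt
    rw [Matrix.of_apply, h1 _ _ (by omega), neg_one_pow_add_sub (by omega)]
  · intro i j hij
    have hij : j.val < i.val := hij
    have := i.isLt
    exact h0 _ _ (by omega)

/-- The Gram matrix with its rows reversed is triangular, which determines its determinant. -/
theorem IsBVector.det_gram {n : ℕ} {F : Fin (2 * n + 1) → 𝕜 → ℂ} {X : Set 𝕜} (hX : IsOpen X)
    (hF : IsBVector n F X) {x : 𝕜} (hx : x ∈ X) :
    ((wronskian F x).submatrix Fin.rev id).det * (Theta n).det * (wronskian F x).det =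
      signProd n (2 * n + 1) := by
  obtain ⟨g0, g1⟩ := hF.gram hX
  rw [← det_antitriangular (b := fun i j => B n (D F i x) (D F j x)) le_rfl
    (fun i j h => g0 i j h x hx) (fun i j h => g1 i j h x hx), ← Matrix.det_transpose
    (wronskian F x), ← Matrix.det_mul, ← Matrix.det_mul]
  congr 1
  ext i j
  rw [Matrix.mul_assoc, Matrix.mul_apply, Matrix.of_apply]
  have hr : (Fin.rev i).val = 2 * n - i.val := by rw [Fin.val_rev]; omega
  refine Finset.sum_congr rfl fun a _ => ?_
  rw [Matrix.submatrix_apply, id, wronskian, Matrix.of_apply, hr]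
  rfl

/-- The determinant of the matrix `Z` with columns `G⁽⁰⁾, …, G⁽ⁿ⁾, ΘF⁽⁰⁾, …, ΘF⁽ⁿ⁻¹⁾` is computed in
two ways. The rows `F⁽ʲ⁾` pair with its columns to a block triangular matrix with the diagonal
blocks of `τₙ₊₁` and of the Gram matrix of `F`; the rows `G⁽ʲ⁾Θ` pair to one with the blocks of the
Gram matrix of `G` and of `τₙ`. -/
theorem tau_succ_eq {n : ℕ} {F G : Fin (2 * n + 1) → 𝕜 → ℂ} {X Y : Set 𝕜} (hX : IsOpen X)
    (hY : IsOpen Y) (hF : IsBVector n F X) (hG : IsBVector n G Y) {x y : 𝕜} (hx : x ∈ X)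
    (hy : y ∈ Y) :
    tau F G (n + 1) (x, y) = signProd n (2 * n + 1) * (wronskian F x).det * (wronskian G y).det *
      tau F G n (x, y) := by
  obtain ⟨f0, f1⟩ := hF.gram hX
  obtain ⟨g0, g1⟩ := hG.gram hY
  let Z : Matrix (Fin (2 * n + 1)) (Fin (2 * n + 1)) ℂ := Matrix.of fun a b =>
    Sum.elim (fun k : Fin (n + 1) => D G k.val y a)
      (fun k : Fin n => ((Theta n).mulVec (D F k.val x)) a) ((splitEquiv n).symm b)
  have hZl : ∀ k, (fun a => Z a (splitEquiv n (Sum.inl k))) = D G k.val y := by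
    intro k; funext a; simp [Z]
  have hZr : ∀ k, (fun a => Z a (splitEquiv n (Sum.inr k))) = (Theta n).mulVec (D F k.val x) := by
    intro k; funext a; simp [Z]
  have hmul : ∀ (A : Matrix (Fin (2 * n + 1)) (Fin (2 * n + 1)) ℂ) i j,
      (A * Z) i j = dotProduct (A i) (fun a => Z a j) := fun A i j => rfl
  have h1 : (wronskian F x).det * Z.det = tau F G (n + 1) (x, y) * signProd n n := by
    rw [← Matrix.det_mul, ← Matrix.det_submatrix_equiv_self (splitEquiv n)]
    have hb : (wronskian F x * Z).submatrix (splitEquiv n) (splitEquiv n) =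
        Matrix.fromBlocks
          (Matrix.of fun j k : Fin (n + 1) => dotProduct (D F j x) (D G k y)) 0
          (Matrix.of fun (j : Fin n) (k : Fin (n + 1)) =>
            dotProduct (D F (2 * n - j.val) x) (D G k y))
          (Matrix.of fun j k : Fin n => B n (D F (2 * n - j.val) x) (D F k.val x)) := by
      ext i j
      rcases i with i | i <;> rcases j with j | j <;>
        simp only [Matrix.submatrix_apply, Matrix.fromBlocks_apply₁₁, Matrix.fromBlocks_apply₁₂,
          Matrix.fromBlocks_apply₂₁, Matrix.fromBlocks_apply₂₂, hmul, hZl, hZr]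
      · rfl
      · exact f0 i j (by omega) x hx
      · rfl
      · rfl
    rw [hb, Matrix.det_fromBlocks_zero₁₂, det_antitriangular (b := fun i j =>
      B n (D F i x) (D F j x)) (by omega) (fun i j h => f0 i j h x hx) (fun i j h => f1 i j h x hx)]
    rfl
  have h2 : ((wronskian G y).submatrix Fin.rev id).det * (Theta n).det * Z.det =
      signProd n (n + 1) * tau F G n (x, y) := by
    rw [← Matrix.det_mul, ← Matrix.det_mul, ← Matrix.det_submatrix_equiv_self (splitEquiv n)]
    have hrow : ∀ i j, ((wronskian G y).submatrix Fin.rev id * Theta n * Z) i j =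
        dotProduct (D G (2 * n - i.val) y) ((Theta n).mulVec fun a => Z a j) := by
      intro i j
      have hr : (Fin.rev i).val = 2 * n - i.val := by rw [Fin.val_rev]; omega
      rw [Matrix.mul_assoc, ← hr]
      rfl
    have hTT : ∀ v, (Theta n).mulVec ((Theta n).mulVec v) = v := by
      intro v; rw [Matrix.mulVec_mulVec, Theta_mul_self, Matrix.one_mulVec]
    have hb : ((wronskian G y).submatrix Fin.rev id * Theta n * Z).submatrix
        (splitEquiv n) (splitEquiv n) =
        Matrix.fromBlocks
          (Matrix.of fun j k : Fin (n + 1) => B n (D G (2 * n - j.val) y) (D G k.val y))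
          (Matrix.of fun (j : Fin (n + 1)) (k : Fin n) =>
            dotProduct (D G (2 * n - j.val) y) (D F k x)) 0
          (Matrix.of fun j k : Fin n => dotProduct (D F j x) (D G k y)).transpose := by
      have hs : ∀ j : Fin n, 2 * n - (splitEquiv n (Sum.inr j)).val = j.val := fun j => by
        change 2 * n - (2 * n - j.val) = j.val
        omega
      ext i j
      rcases i with i | i <;> rcases j with j | j <;>
        simp only [Matrix.submatrix_apply, Matrix.fromBlocks_apply₁₁, Matrix.fromBlocks_apply₁₂,
          Matrix.fromBlocks_apply₂₁, Matrix.fromBlocks_apply₂₂, hrow, hZl, hZr, hTT, hs]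
      · rfl
      · rfl
      · exact g0 i j (by omega) y hy
      · exact dotProduct_comm _ _
    rw [hb, Matrix.det_fromBlocks_zero₂₁, det_antitriangular (b := fun i j =>
      B n (D G i y) (D G j y)) (by omega) (fun i j h => g0 i j h y hy) (fun i j h => g1 i j h y hy),
      Matrix.det_transpose]
    rfl
  have h3 := hG.det_gram hY hy
  have e1 := signProd_mul_self n (2 * n + 1)
  have e2 := signProd_mul_self n n
  rw [signProd_succ_self] at h2
  -- multiplying `h2` by `det (wronskian G y)` turns its left factor into the sign `h3`
  have h4 : signProd n (2 * n + 1) * Z.det =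
      signProd n n * tau F G n (x, y) * (wronskian G y).det := by
    linear_combination (wronskian G y).det * h2 - Z.det * h3
  have h5 : Z.det = signProd n (2 * n + 1) *
      (signProd n n * tau F G n (x, y) * (wronskian G y).det) := by
    linear_combination signProd n (2 * n + 1) * h4 - Z.det * e1
  rw [h5] at h1
  linear_combination -signProd n n * h1 + (signProd n (2 * n + 1) * (wronskian F x).det *
    (wronskian G y).det * tau F G n (x, y) - tau F G (n + 1) (x, y)) * e2

/-- The common square of all Wronskian determinants of `Bₙ`-vectors. -/
def wronskianSq (n : ℕ) : ℂ :=
  signProd n (2 * n + 1) * ((Equiv.Perm.sign (Fin.revPerm (n := 2 * n + 1)) : ℤ) : ℂ) *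
    (Theta n).det

theorem sign_revPerm_mul_self (n : ℕ) :
    ((Equiv.Perm.sign (Fin.revPerm (n := n)) : ℤ) : ℂ) *
      ((Equiv.Perm.sign (Fin.revPerm (n := n)) : ℤ) : ℂ) = 1 := by
  rw [← Int.cast_mul, ← Units.val_mul, Int.units_mul_self]; simp

theorem det_Theta_mul_self (n : ℕ) : (Theta n).det * (Theta n).det = 1 := by
  rw [← Matrix.det_mul, Theta_mul_self, Matrix.det_one]

theorem wronskianSq_mul_self (n : ℕ) : wronskianSq n * wronskianSq n = 1 := by
  unfold wronskianSq
  rw [mul_mul_mul_comm, det_Theta_mul_self, mul_mul_mul_comm, signProd_mul_self,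
    sign_revPerm_mul_self]
  simp

theorem IsBVector.sq_det_wronskian {n : ℕ} {F : Fin (2 * n + 1) → 𝕜 → ℂ} {X : Set 𝕜}
    (hX : IsOpen X) (hF : IsBVector n F X) {x : 𝕜} (hx : x ∈ X) :
    (wronskian F x).det ^ 2 = wronskianSq n := by
  have h := hF.det_gram hX hx
  have hp : ((wronskian F x).submatrix Fin.rev id).det =
      ((Equiv.Perm.sign (Fin.revPerm (n := 2 * n + 1)) : ℤ) : ℂ) * (wronskian F x).det :=
    Matrix.det_permute (Fin.revPerm (n := 2 * n + 1)) (wronskian F x)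
  rw [hp] at h
  rw [wronskianSq, ← h]
  linear_combination (-(wronskian F x).det ^ 2) * (sign_revPerm_mul_self (2 * n + 1) +
    (((Equiv.Perm.sign (Fin.revPerm (n := 2 * n + 1)) : ℤ) : ℂ) ^ 2) * det_Theta_mul_self n)

theorem IsBVector.det_wronskian_const {n : ℕ} {F : Fin (2 * n + 1) → 𝕜 → ℂ} {X : Set 𝕜}
    (hX : IsOpen X) (hc : IsPreconnected X) (hF : IsBVector n F X) {x z : 𝕜} (hx : x ∈ X)
    (hz : z ∈ X) : (wronskian F x).det = (wronskian F z).det := by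
  have hcont : ContinuousOn (fun x => (wronskian F x).det) X := by
    refine ContinuousOn.congr (f := fun x => ∑ σ : Equiv.Perm (Fin (2 * n + 1)),
      ((Equiv.Perm.sign σ : ℤ) : ℂ) * ∏ j, iteratedDeriv (σ j).val (F j) x) ?_
      (fun x _ => Matrix.det_apply' _)
    exact continuousOn_finsetSum _ fun σ _ => continuousOn_const.mul
      (continuousOn_finsetProd _ fun j _ =>
        (contDiffOn_iteratedDeriv hX (hF.smooth j) _).continuousOn)
  have hz0 : (wronskian F z).det ≠ 0 := by
    intro h0
    have h := hF.det_gram hX hz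
    rw [h0, mul_zero] at h
    have := signProd_mul_self n (2 * n + 1)
    rw [← h] at this
    simp at this
  refine hc.eq_of_sq_eq hcont (continuousOn_const (c := (wronskian F z).det)) (fun w hw => ?_)
    (fun _ => hz0) hz rfl hx
  simp only [Pi.pow_apply]
  rw [hF.sq_det_wronskian hX hw, hF.sq_det_wronskian hX hz]

/-- On preconnected domains `τₙ₊₁ = ε τₙ` for a constant sign `ε`. -/
theorem exists_sign {n : ℕ} {F G : Fin (2 * n + 1) → 𝕜 → ℂ} {X Y : Set 𝕜} (hX : IsOpen X)
    (hXc : IsPreconnected X) (hY : IsOpen Y) (hYc : IsPreconnected Y) (hF : IsBVector n F X)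
    (hG : IsBVector n G Y) : ∃ ε : ℂ, (ε = 1 ∨ ε = -1) ∧
      ∀ x ∈ X, ∀ y ∈ Y, tau F G (n + 1) (x, y) = ε * tau F G n (x, y) := by
  rcases X.eq_empty_or_nonempty with rfl | ⟨x₀, hx₀⟩
  · exact ⟨1, Or.inl rfl, by simp⟩
  rcases Y.eq_empty_or_nonempty with rfl | ⟨y₀, hy₀⟩
  · exact ⟨1, Or.inl rfl, by simp⟩
  refine ⟨signProd n (2 * n + 1) * (wronskian F x₀).det * (wronskian G y₀).det, ?_, ?_⟩
  · rw [← sq_eq_one_iff, mul_pow, mul_pow, hF.sq_det_wronskian hX hx₀,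
      hG.sq_det_wronskian hY hy₀, mul_assoc, wronskianSq_mul_self, sq, signProd_mul_self, one_mul]
  · intro x hx y hy
    rw [tau_succ_eq hX hY hF hG hx hy, hF.det_wronskian_const hX hXc hx hx₀,
      hG.det_wronskian_const hY hYc hy hy₀]

end LastTau

/-! ### Logarithms of `τ` and the Toda system -/

section Toda

variable {𝕜 : Type*} [RCLike 𝕜] [NormedAlgebra 𝕜 ℂ]

/-- Near a point `p`, a continuous branch `l` of `log v` is `l(p)` plus the principal logarithm of
`v / v(p)`. -/
theorem IsLogBranch.contDiffOn {E : Type*} [NormedAddCommGroup E] [NormedSpace 𝕜 E] {v l : E → ℂ}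
    {S : Set E} (hS : IsOpen S) (hv : ContDiffOn 𝕜 ∞ v S) (hl : IsLogBranch v l S) :
    ContDiffOn 𝕜 ∞ l S := by
  intro p hp
  have hvp : v p ≠ 0 := by rw [← hl.2 p hp]; exact Complex.exp_ne_zero _
  have hv1 : ContDiffAt 𝕜 ∞ (fun q => v q * (v p)⁻¹) p :=
    (hv.contDiffAt (hS.mem_nhds hp)).mul contDiffAt_const
  have hlog : ContDiffAt 𝕜 ∞ Complex.log (v p * (v p)⁻¹) := by
    refine (Complex.contDiffAt_log ?_).restrict_scalars 𝕜
    rw [mul_inv_cancel₀ hvp]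
    exact Complex.one_mem_slitPlane
  have h : ContDiffAt 𝕜 ∞ (fun q => l p + Complex.log (v q * (v p)⁻¹)) p :=
    contDiffAt_const.add (ContDiffAt.comp (g := Complex.log) p hlog hv1)
  refine (h.congr_of_eventuallyEq ?_).contDiffWithinAt
  have hc : ContinuousAt l p := hl.1.continuousAt (hS.mem_nhds hp)
  filter_upwards [hS.mem_nhds hp, hc (Metric.ball_mem_nhds (l p) one_pos)] with q hq hq'
  have hq' : ‖l q - l p‖ < 1 := by simpa [dist_eq_norm] using hq'
  have him := abs_lt.1 ((Complex.abs_im_le_norm _).trans_lt hq')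
  have hpi := Real.pi_gt_three
  rw [← hl.2 q hq, ← hl.2 p hp, ← Complex.exp_neg, ← Complex.exp_add, ← sub_eq_add_neg,
    Complex.log_exp (by linarith) (by linarith)]
  ring

theorem hasDerivAt_of_exp_eq {l v : 𝕜 → ℂ} {x : 𝕜} {v' : ℂ} (hl : DifferentiableAt 𝕜 l x)
    (h : ∀ᶠ z in 𝓝 x, Complex.exp (l z) = v z) (hv : HasDerivAt v v' x) :
    HasDerivAt l (v' / v x) x := by
  have h1 := hl.hasDerivAt.cexp.unique (hv.congr_of_eventuallyEq h)
  refine hl.hasDerivAt.congr_deriv ?_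
  rw [← h1, ← h.self_of_nhds, mul_div_cancel_left₀ _ (Complex.exp_ne_zero _)]

/-- By the Desnanot–Jacobi identity, `∂_y ∂_x log τᵢ = τᵢ₋₁ τᵢ₊₁ / τᵢ²`. -/
theorem mixedDeriv_log_tau {m : ℕ} {F G : Fin m → 𝕜 → ℂ} {X Y : Set 𝕜} (hX : IsOpen X)
    (hY : IsOpen Y) (hF : ∀ k, ContDiffOn 𝕜 ∞ (F k) X) (hG : ∀ k, ContDiffOn 𝕜 ∞ (G k) Y)
    {S : Set (𝕜 × 𝕜)} (hS : IsOpen S) (hSXY : S ⊆ X ×ˢ Y) {N : ℕ} {l : 𝕜 × 𝕜 → ℂ}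
    (hl : IsLogBranch (tau F G (N + 1)) l S) (c : ℂ) {p : 𝕜 × 𝕜} (hp : p ∈ S)
    (hN : tau F G N p ≠ 0) :
    mixedDeriv (fun q => c * l q) p =
      c * (tau F G N p * tau F G (N + 2) p / tau F G (N + 1) p ^ 2) := by
  obtain ⟨x, y⟩ := p
  have hx : x ∈ X := (hSXY hp).1
  have hsm := hl.contDiffOn hS ((contDiffOn_tau hX hY hF hG (N + 1)).mono hSXY)
  have hτ : ∀ q ∈ S, tau F G (N + 1) q ≠ 0 := fun q hq => by
    rw [← hl.2 q hq]; exact Complex.exp_ne_zero _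
  have hxd : ∀ y', (x, y') ∈ S → HasDerivAt (fun z => l (z, y'))
      (minor F G (bordered N (N + 1)) (bordered N N) x y' / tau F G (N + 1) (x, y')) x := by
    intro y' hy'
    refine hasDerivAt_of_exp_eq (v := fun z => tau F G (N + 1) (z, y')) ?_ ?_ ?_
    · exact ((hsm.contDiffAt (hS.mem_nhds hy')).differentiableAt (by simp)).comp x
        (f := fun z => (z, y')) (by fun_prop)
    · have hc : ContinuousAt (fun z : 𝕜 => (z, y')) x := by fun_prop
      filter_upwards [hc (hS.mem_nhds hy')] with z hz using hl.2 _ hz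
    · simp only [tau_succ]
      exact hasDerivAt_minor_left hX hF G _ hx y'
  have hc : ContinuousAt (fun y' : 𝕜 => (x, y')) y := by fun_prop
  have hev : (fun y' => deriv (fun z => c * l (z, y')) x) =ᶠ[𝓝 y] fun y' =>
      c * (minor F G (bordered N (N + 1)) (bordered N N) x y' *
        (minor F G (bordered N N) (bordered N N) x y')⁻¹) := by
    filter_upwards [hc (hS.mem_nhds hp)] with y' hy'
    rw [((hxd y' hy').const_mul c).deriv, tau_succ, div_eq_mul_inv]
  have hy : y ∈ Y := (hSXY hp).2
  have h0 := hτ _ hp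
  rw [tau_succ] at h0
  have hd := (((hasDerivAt_minor_right hY hG F (bordered N (N + 1)) x hy).fun_mul
    ((hasDerivAt_minor_right hY hG F (bordered N N) x hy).fun_inv h0)).const_mul c)
  rw [mixedDeriv, hev.deriv_eq, hd.deriv, tau_mul_tau F G N hN, tau_succ]
  field_simp
  ring

theorem sum_ite_val {n : ℕ} (k : ℕ) (c : ℂ) :
    (∑ j : Fin n, if j.val = k then c else 0) = if k < n then c else 0 := by
  rw [← Finset.sum_range fun j => if j = k then c else 0, Finset.sum_ite_eq']
  simp

theorem cartan_sum {n : ℕ} (i : Fin n) {L : ℕ → ℂ} (hL : L 0 = 0) :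
    ∑ j : Fin n, ((CartanMatrix.B n i j : ℤ) : ℂ) *
      ((if j.val + 1 = n then -(1 / 2) else -1) * L (j.val + 1)) =
      if i.val + 1 = n then L i - L (i + 1) else L i - 2 * L (i + 1) + L (i + 2) := by
  have hi := i.isLt
  have hterm : ∀ j : Fin n, ((CartanMatrix.B n i j : ℤ) : ℂ) *
      ((if j.val + 1 = n then -(1 / 2) else -1) * L (j.val + 1)) =
      (if j.val + 1 = i.val then L i else 0) +
      (if j.val = i.val then (if i.val + 1 = n then -1 else -2) * L (i + 1) else 0) +
      (if j.val = i.val + 1 then L (i + 2) else 0) := by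
    intro j
    have hj := j.isLt
    simp only [CartanMatrix.B, Matrix.of_apply, Fin.ext_iff]
    rcases lt_trichotomy j.val i.val with h | h | h
    · rw [if_neg (by omega : ¬ i.val = j.val), if_neg (by omega : ¬ i.val + 1 = j.val),
        if_neg (by omega : ¬ j.val + 1 = n), if_neg (by omega : ¬ j.val = i.val),
        if_neg (by omega : ¬ j.val = i.val + 1)]
      by_cases h' : j.val + 1 = i.val
      · simp [h']
      · simp [h']
    · rw [if_pos h.symm, if_neg (by omega : ¬ j.val + 1 = i.val), if_pos h,
        if_neg (by omega : ¬ j.val = i.val + 1), h]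
      split_ifs <;> push_cast <;> ring
    · rw [if_neg (by omega : ¬ i.val = j.val), if_neg (by omega : ¬ j.val + 1 = i.val),
        if_neg (by omega : ¬ j.val + 1 = i.val), if_neg (by omega : ¬ j.val = i.val)]
      by_cases h' : j.val = i.val + 1
      · rw [if_pos h'.symm, if_pos h', h']
        by_cases h'' : i.val + 1 = n - 1
        · rw [if_pos h'', if_pos (by omega)]; push_cast; ring
        · rw [if_neg h'', if_neg (by omega)]; push_cast; ring
      · rw [if_neg (fun h => h' h.symm), if_neg h']; simp
  have h1 : (∑ j : Fin n, if j.val + 1 = i.val then L i else 0) = L i := by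
    rcases Nat.eq_zero_or_pos i.val with h0 | h0
    · rw [h0, hL]; simp
    · have he : ∀ j : Fin n, (if j.val + 1 = i.val then L i else 0) =
          if j.val = i.val - 1 then L i else 0 := fun j => if_congr (by omega) rfl rfl
      simp only [he]
      rw [sum_ite_val, if_pos (by omega)]
  simp only [hterm, Finset.sum_add_distrib]
  rw [h1, sum_ite_val, sum_ite_val, if_pos hi]
  by_cases h : i.val + 1 = n
  · rw [if_pos h, if_pos h, if_neg (by omega)]; ring
  · rw [if_neg h, if_neg h, if_pos (by omega)]; ring

theorem isTodaSolution_of_sign {n : ℕ} {F G : Fin (2 * n + 1) → 𝕜 → ℂ} {X Y : Set 𝕜}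
    (hX : IsOpen X) (hY : IsOpen Y) (hF : ∀ k, ContDiffOn 𝕜 ∞ (F k) X)
    (hG : ∀ k, ContDiffOn 𝕜 ∞ (G k) Y) {ε : ℂ}
    (hε : ∀ x ∈ X, ∀ y ∈ Y, tau F G (n + 1) (x, y) = ε * tau F G n (x, y))
    {S : Set (𝕜 × 𝕜)} (hS : IsOpen S) (hSXY : S ⊆ X ×ˢ Y) {l : Fin n → 𝕜 × 𝕜 → ℂ}
    (hl : ∀ i, IsLogBranch (tau F G (i.val + 1)) (l i) S) :
    IsTodaSolution n (ε / 2)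
      (fun i p => if i.val + 1 = n then -(1 / 2) * l i p else -l i p) S := by
  have hu : (fun (i : Fin n) p => if i.val + 1 = n then -(1 / 2) * l i p else -l i p) =
      fun i p => (if i.val + 1 = n then -(1 / 2) else -1) * l i p := by
    funext i p
    split_ifs <;> ring
  rw [hu]
  refine ⟨fun i => contDiffOn_const.mul ((hl i).contDiffOn hS
    ((contDiffOn_tau hX hY hF hG _).mono hSXY)), fun i p hp => ?_⟩
  -- `L k` is a logarithm of `τₖ(p)` for `0 ≤ k ≤ n`, with `τ₀ = 1`
  let L : ℕ → ℂ := fun k => if h : 0 < k ∧ k ≤ n then l ⟨k - 1, by omega⟩ p else 0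
  have hL0 : L 0 = 0 := by simp [L]
  have hLs : ∀ j : Fin n, l j p = L (j.val + 1) := by
    intro j
    simp [L, Nat.succ_le_of_lt j.isLt]
  have hLexp : ∀ k ≤ n, Complex.exp (L k) = tau F G k p := by
    intro k hk
    rcases k with _ | k
    · rw [hL0]; simp [tau]
    · rw [← hLs ⟨k, by omega⟩]; exact (hl ⟨k, by omega⟩).2 p hp
  have hne : ∀ k ≤ n, tau F G k p ≠ 0 := fun k hk => by
    rw [← hLexp k hk]; exact Complex.exp_ne_zero _
  have hi := i.isLt
  rw [mixedDeriv_log_tau hX hY hF hG hS hSXY (hl i) _ hp (hne i (by omega))]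
  simp only [hLs]
  rw [cartan_sum i hL0]
  by_cases h : i.val + 1 = n
  · have hlast : ∀ k, k = n → tau F G (k + 1) p = ε * tau F G k p := by
      rintro k rfl
      exact hε p.1 (hSXY hp).1 p.2 (hSXY hp).2
    have he := hlast (i.val + 1) h
    rw [if_pos h, if_pos h, if_pos h, Complex.exp_sub, hLexp _ (by omega), hLexp _ (by omega), he]
    have := hne (i.val + 1) (by omega)
    field_simp
  · have hsq : Complex.exp (2 * L (i.val + 1)) =
        Complex.exp (L (i.val + 1)) * Complex.exp (L (i.val + 1)) := by
      rw [two_mul, Complex.exp_add]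
    rw [if_neg h, if_neg h, if_neg h, Complex.exp_add, Complex.exp_sub, hsq,
      hLexp _ (by omega), hLexp _ (by omega), hLexp _ (by omega)]
    have := hne (i.val + 1) (by omega)
    field_simp

end Toda

/-! ### Leznov's vectors are `Bₙ`-vectors -/

section Leznov

theorem form_congr {n : ℕ} {v v' w w' : ℕ → ℂ} (hv : ∀ m ≤ 2 * n, v m = v' m)
    (hw : ∀ m ≤ 2 * n, w m = w' m) : form n v w = form n v' w' :=
  Finset.sum_congr rfl fun m hm => by
    have := Finset.mem_range.1 hm
    rw [hv m (by omega), hw (2 * n - m) (by omega)]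

theorem form_mul_left (n : ℕ) (c : ℂ) (v w : ℕ → ℂ) :
    form n (fun m => c * v m) w = c * form n v w := by
  rw [form, form, Finset.mul_sum]
  exact Finset.sum_congr rfl fun m _ => by ring

theorem form_mul_right (n : ℕ) (c : ℂ) (v w : ℕ → ℂ) :
    form n v (fun m => c * w m) = c * form n v w := by
  rw [form, form, Finset.mul_sum]
  exact Finset.sum_congr rfl fun m _ => by ring

/-- The `k`-th letter (from `k = 0`) of the sequence `1, 2, …, n, n, …, 2, 1`. -/
def letter (n k : ℕ) : ℕ := if k < n then k + 1 else 2 * n - k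

theorem letter_mem {n k : ℕ} (hk : k < 2 * n) : letter n k ∈ Finset.Icc 1 n := by
  rw [Finset.mem_Icc]
  unfold letter
  split_ifs <;> omega

theorem letter_eq_letter {n k l : ℕ} (h : k + l + 1 = 2 * n) : letter n k = letter n l := by
  unfold letter
  split_ifs <;> omega

theorem map_letter_up {n m : ℕ} (h : m ≤ n) : (List.range' 0 m).map (letter n) = up m := by
  refine List.ext_getElem (by simp [up]) fun i h1 h2 => ?_
  have : i < m := by simpa using h1
  simp [up, letter, (by omega : i < n), add_comm]

theorem map_letter_down {n m : ℕ} (h : n ≤ m) (h' : m ≤ 2 * n) :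
    (List.range' 0 m).map (letter n) = up n ++ down n (2 * n - m + 1) := by
  refine List.ext_getElem (by simp [up, down]; omega) fun i h1 h2 => ?_
  have : i < m := by simpa using h1
  rw [List.getElem_append]
  by_cases hi : i < n
  · simp [up, letter, hi, add_comm]
  · simp [up, down, letter, hi]
    omega

variable {𝕜 : Type*} [RCLike 𝕜] [NormedAlgebra 𝕜 ℂ]

/-- If `Q_a' = d_a Q_{a+1}` and `P_{k+1} = (e_k P_k)'`, starting from `P₀ = p Q₀`, then `P_k` is a
combination of `Q₀, …, Q_k` with last coefficient `p ∏ e_j d_j`. -/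
theorem exists_triangular_combination {M K : ℕ} {U : Set 𝕜} (hU : IsOpen U)
    {P Q : ℕ → ℕ → 𝕜 → ℂ} {d e : ℕ → 𝕜 → ℂ} {p : 𝕜 → ℂ}
    (hd : ∀ a < K, ContDiffOn 𝕜 ∞ (d a) U) (he : ∀ a < K, ContDiffOn 𝕜 ∞ (e a) U)
    (hp : ContDiffOn 𝕜 ∞ p U)
    (hQ : ∀ a < K, ∀ m ≤ M, ∀ x ∈ U, HasDerivAt (Q a m) (d a x * Q (a + 1) m x) x)
    (hP : ∀ k < K, ∀ m ≤ M, ∀ x ∈ U,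
      HasDerivAt (fun x => e k x * P k m x) (P (k + 1) m x) x)
    (h0 : ∀ m ≤ M, ∀ x ∈ U, P 0 m x = p x * Q 0 m x) (k : ℕ) (hk : k ≤ K) :
    ∃ α : ℕ → 𝕜 → ℂ, (∀ a ≤ k, ContDiffOn 𝕜 ∞ (α a) U) ∧
      (∀ x ∈ U, α k x = p x * ∏ j ∈ Finset.range k, (e j x * d j x)) ∧
      ∀ m ≤ M, ∀ x ∈ U, P k m x = ∑ a ∈ Finset.range (k + 1), α a x * Q a m x := by
  induction k with
  | zero => exact ⟨fun _ => p, fun _ _ => hp, by simp, by simpa using h0⟩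
  | succ k ih =>
    obtain ⟨α, hα, hαk, hPk⟩ := ih (by omega)
    have hk' : k < K := hk
    have heα : ∀ a ≤ k, ContDiffOn 𝕜 ∞ (fun x => e k x * α a x) U := fun a ha =>
      (he k hk').mul (hα a ha)
    refine ⟨fun a x => (if a ≤ k then deriv (fun x => e k x * α a x) x else 0) +
      (if 0 < a then e k x * α (a - 1) x * d (a - 1) x else 0), fun a ha => ?_, fun x hx => ?_,
      fun m hm x hx => ?_⟩
    · refine ContDiffOn.add ?_ ?_
      · by_cases h : a ≤ k
        · simpa only [if_pos h] using contDiffOn_deriv hU (heα a h)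
        · simpa only [if_neg h] using contDiffOn_const
      · by_cases h : 0 < a
        · simpa only [if_pos h] using (heα (a - 1) (by omega)).mul (hd (a - 1) (by omega))
        · simpa only [if_neg h] using contDiffOn_const
    · beta_reduce
      rw [if_neg (by omega), if_pos (by omega), Nat.add_sub_cancel, hαk x hx,
        Finset.prod_range_succ]
      ring
    · have h1 := hP k hk' m hm x hx
      have h2 : HasDerivAt (fun x => e k x * P k m x)
          (∑ a ∈ Finset.range (k + 1), (deriv (fun x => e k x * α a x) x * Q a m x +
            e k x * α a x * (d a x * Q (a + 1) m x))) x := by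
        have h3 : HasDerivAt (fun x => ∑ a ∈ Finset.range (k + 1), (e k x * α a x) * Q a m x)
            (∑ a ∈ Finset.range (k + 1), (deriv (fun x => e k x * α a x) x * Q a m x +
            e k x * α a x * (d a x * Q (a + 1) m x))) x := by
          refine HasDerivAt.fun_sum fun a ha => ?_
          have ha' : a ≤ k := by have := Finset.mem_range.1 ha; omega
          exact (differentiableAt_of_contDiffOn hU (heα a ha') hx).hasDerivAt.mul
            (hQ a (by omega) m hm x hx)
        refine h3.congr_of_eventuallyEq ?_
        filter_upwards [hU.mem_nhds hx] with z hz
        rw [hPk m hm z hz, Finset.mul_sum]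
        exact Finset.sum_congr rfl fun a _ => by ring
      rw [h1.unique h2]
      simp only [add_mul, Finset.sum_add_distrib]
      congr 1
      · rw [Finset.sum_range_succ _ (k + 1), if_neg (by omega), zero_mul, add_zero]
        refine Finset.sum_congr rfl fun a ha => ?_
        rw [if_pos (by have := Finset.mem_range.1 ha; omega)]
      · rw [Finset.sum_range_succ' _ (k + 1)]
        simp only [lt_irrefl, if_false, zero_mul, add_zero, Nat.succ_pos, if_true,
          Nat.add_sub_cancel]
        exact Finset.sum_congr rfl fun a _ => by ring

theorem contDiffOn_iterInt {X : Set 𝕜} (hX : IsOpen X) (hs : StarConvex ℝ (0 : 𝕜) X)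
    {φ : ℕ → 𝕜 → ℂ} {s : List ℕ} (hφ : ∀ a ∈ s, ContDiffOn 𝕜 ∞ (φ a) X) :
    ContDiffOn 𝕜 ∞ (iterInt φ s) X := by
  induction s with
  | nil => exact contDiffOn_const
  | cons a s ih =>
    exact contDiffOn_primitive hX hs ((hφ a (by simp)).mul
      (ih fun b hb => hφ b (by simp [hb])))

/-- The iterated integral over the letters with indices `k, …, m - 1`, continued by zero outside
`k ≤ m ≤ 2n`. For fixed `k` these are the coordinates of the `k`-th vector of a frame that moves by
`v_k' = φ v_{k+1}`. -/
def frame (n : ℕ) (φ : ℕ → 𝕜 → ℂ) (k m : ℕ) : 𝕜 → ℂ :=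
  if k ≤ m ∧ m ≤ 2 * n then iterInt φ ((List.range' k (m - k)).map (letter n)) else fun _ => 0

theorem frame_of_lt {n k m : ℕ} (φ : ℕ → 𝕜 → ℂ) (h : m < k) (x : 𝕜) : frame n φ k m x = 0 := by
  rw [frame, if_neg (by omega)]

theorem frame_self {n k : ℕ} (φ : ℕ → 𝕜 → ℂ) (h : k ≤ 2 * n) (x : 𝕜) : frame n φ k k x = 1 := by
  rw [frame, if_pos ⟨le_rfl, h⟩, Nat.sub_self]
  rfl

theorem frame_of_gt {n k m : ℕ} (φ : ℕ → 𝕜 → ℂ) (h : k < m) (hm : m ≤ 2 * n) :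
    frame n φ k m = primitive fun x => φ (letter n k) x * frame n φ (k + 1) m x := by
  rw [frame, if_pos ⟨h.le, hm⟩, show m - k = (m - (k + 1)) + 1 by omega, List.range'_succ,
    List.map_cons, frame, if_pos ⟨h, hm⟩]
  rfl

theorem frame_zero {n k m : ℕ} (φ : ℕ → 𝕜 → ℂ) (h : m ≠ k) : frame n φ k m 0 = 0 := by
  rcases lt_or_gt_of_ne h with h | h
  · exact frame_of_lt φ h 0
  · by_cases hm : m ≤ 2 * n
    · rw [frame_of_gt φ h hm, primitive_zero]
    · rw [frame, if_neg (by omega)]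

theorem contDiffOn_frame {X : Set 𝕜} (hX : IsOpen X) (hs : StarConvex ℝ (0 : 𝕜) X) {n : ℕ}
    {φ : ℕ → 𝕜 → ℂ} (hφ : ∀ a ∈ Finset.Icc 1 n, ContDiffOn 𝕜 ∞ (φ a) X) (k m : ℕ) :
    ContDiffOn 𝕜 ∞ (frame n φ k m) X := by
  unfold frame
  split_ifs with h
  · refine contDiffOn_iterInt hX hs fun a ha => ?_
    obtain ⟨b, hb, rfl⟩ := List.mem_map.1 ha
    have := List.mem_range'_1.1 hb
    exact hφ _ (letter_mem (by omega))
  · exact contDiffOn_const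

theorem hasDerivAt_frame {X : Set 𝕜} (hX : IsOpen X) (hs : StarConvex ℝ (0 : 𝕜) X) {n : ℕ}
    {φ : ℕ → 𝕜 → ℂ} (hφ : ∀ a ∈ Finset.Icc 1 n, ContDiffOn 𝕜 ∞ (φ a) X) (k m : ℕ) {x : 𝕜}
    (hx : x ∈ X) :
    HasDerivAt (frame n φ k m) (φ (letter n k) x * frame n φ (k + 1) m x) x := by
  rcases lt_or_ge m (k + 1) with h | h
  · rw [frame_of_lt φ h, mul_zero]
    rcases Nat.lt_or_eq_of_le (Nat.lt_succ_iff.1 h) with h' | rfl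
    · rw [frame, if_neg (by omega)]
      exact hasDerivAt_const _ _
    · rw [frame, Nat.sub_self]
      split_ifs <;> exact hasDerivAt_const _ _
  · by_cases hm : m ≤ 2 * n
    · rw [frame_of_gt φ h hm]
      exact hasDerivAt_primitive hX hs
        ((hφ _ (letter_mem (by omega))).mul (contDiffOn_frame hX hs hφ _ _)) hx
    · rw [frame, frame, if_neg (by omega), if_neg (by omega), mul_zero]
      exact hasDerivAt_const _ _

/-- The frame has a constant antidiagonal Gram matrix: the derivatives of the products of frame
vectors cancel, because the sequence of letters is a palindrome. -/
theorem form_frame {X : Set 𝕜} (hX : IsOpen X) (h0 : (0 : 𝕜) ∈ X) (hs : StarConvex ℝ (0 : 𝕜) X)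
    {n : ℕ} {φ : ℕ → 𝕜 → ℂ} (hφ : ∀ a ∈ Finset.Icc 1 n, ContDiffOn 𝕜 ∞ (φ a) X) (d : ℕ) :
    ∀ k l, k + l + d = 2 * n → ∀ x ∈ X,
      form n (fun m => frame n φ k m x) (fun m => frame n φ l m x) =
        if d = 0 then (-1) ^ (n + k) else 0 := by
  induction d with
  | zero =>
    intro k l hkl x _
    rw [form_of_triangular (by omega) (fun m hm => frame_of_lt φ hm x)
      (fun m hm => frame_of_lt φ hm x), frame_self φ (by omega), frame_self φ (by omega)]
    simp
  | succ d ih =>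
    intro k l hkl x hx
    rw [if_neg (by omega)]
    have hder : ∀ z ∈ X, HasDerivAt (fun x => form n (fun m => frame n φ k m x)
        (fun m => frame n φ l m x)) 0 z := by
      intro z hz
      refine (hasDerivAt_form n (fun m _ => hasDerivAt_frame hX hs hφ k m hz)
        (fun m _ => hasDerivAt_frame hX hs hφ l m hz)).congr_deriv ?_
      rw [form_mul_left, form_mul_right, ih (k + 1) l (by omega) z hz,
        ih k (l + 1) (by omega) z hz]
      by_cases hd : d = 0
      · rw [if_pos hd, if_pos hd, letter_eq_letter (n := n) (k := k) (l := l) (by omega)]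
        ring
      · rw [if_neg hd, if_neg hd]; ring
    rw [eq_of_hasDerivAt_zero hX (isPreconnected_of_starConvex hs) hder hx h0]
    refine form_eq_zero fun m hm => ?_
    by_cases h : m = k
    · exact Or.inr (frame_zero φ (by omega))
    · exact Or.inl (frame_zero φ h)

theorem word_leznov {n m : ℕ} (hm : m ≤ 2 * n) (φ : ℕ → 𝕜 → ℂ) (x : 𝕜) :
    word n (fun i => leznov n φ i x) m =
      1 / (∏ k ∈ Finset.Icc 1 n, φ k x) * frame n φ 0 m x := by
  rw [frame, if_pos ⟨Nat.zero_le _, hm⟩, Nat.sub_zero]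
  have hw := wordSign_mul_self n m
  rcases lt_or_ge m n with h | h
  · rw [map_letter_up h.le]
    simp only [word, leznov, wordIndex, wordSign, if_pos h] at hw ⊢
    linear_combination (1 / (∏ k ∈ Finset.Icc 1 n, φ k x) * iterInt φ (up m) x) * hw
  · have h' : ¬ m < n := by omega
    have h3 : ¬ 3 * n - m < n := by omega
    simp only [word, leznov, wordIndex, wordSign, if_neg h', if_neg h3, one_mul]
    rcases Nat.lt_or_eq_of_le h with h4 | rfl
    · rw [if_pos (by omega), map_letter_down h hm, show 3 * n - m - n = 2 * n - m by omega]
    · rw [if_neg (by omega), map_letter_up le_rfl]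

theorem prod_letter (n : ℕ) (f : ℕ → ℂ) :
    ∏ j ∈ Finset.range n, f (letter n j) = ∏ k ∈ Finset.Icc 1 n, f k := by
  refine Finset.prod_bij (fun j _ => j + 1) ?_ ?_ ?_ ?_
  · intro j hj
    have := Finset.mem_range.1 hj
    exact Finset.mem_Icc.2 ⟨by omega, by omega⟩
  · intro i _ j _ h
    omega
  · intro k hk
    have := Finset.mem_Icc.1 hk
    exact ⟨k - 1, Finset.mem_range.2 (by omega), by omega⟩
  · intro j hj
    rw [letter, if_pos (Finset.mem_range.1 hj)]

theorem contDiffOn_one_div_prod {X : Set 𝕜} {n : ℕ} {φ : ℕ → 𝕜 → ℂ}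
    (hφ : ∀ k ∈ Finset.Icc 1 n, ContDiffOn 𝕜 ∞ (φ k) X ∧ ∀ x ∈ X, φ k x ≠ 0) :
    ContDiffOn 𝕜 ∞ (fun x => 1 / ∏ k ∈ Finset.Icc 1 n, φ k x) X := by
  simp only [one_div]
  exact (contDiffOn_prod fun k hk => (hφ k hk).1).inv
    fun x hx => Finset.prod_ne_zero_iff.2 fun k hk => (hφ k hk).2 x hx

theorem contDiffOn_leznov {X : Set 𝕜} (hX : IsOpen X) (hs : StarConvex ℝ (0 : 𝕜) X) {n : ℕ}
    {φ : ℕ → 𝕜 → ℂ} (hφ : ∀ k ∈ Finset.Icc 1 n, ContDiffOn 𝕜 ∞ (φ k) X ∧ ∀ x ∈ X, φ k x ≠ 0)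
    (i : Fin (2 * n + 1)) : ContDiffOn 𝕜 ∞ (leznov n φ i) X := by
  have hi := i.isLt
  have hm : (wordIndex n i.val).val ≤ 2 * n := by have := (wordIndex n i.val).isLt; omega
  refine (contDiffOn_const (c := wordSign n (wordIndex n i.val).val)).mul ((contDiffOn_one_div_prod hφ).mul
    (contDiffOn_frame hX hs (fun k hk => (hφ k hk).1) 0 (wordIndex n i.val).val)) |>.congr ?_
  intro x _
  have h := word_leznov hm φ x
  rw [← h, word, wordIndex_wordIndex, ← mul_assoc, wordSign_mul_self, one_mul]

theorem isBVector_leznov {X : Set 𝕜} (hX : IsOpen X) (h0 : (0 : 𝕜) ∈ X)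
    (hs : StarConvex ℝ (0 : 𝕜) X) {n : ℕ} {φ : ℕ → 𝕜 → ℂ}
    (hφ : ∀ k ∈ Finset.Icc 1 n, ContDiffOn 𝕜 ∞ (φ k) X ∧ ∀ x ∈ X, φ k x ≠ 0) :
    IsBVector n (leznov n φ) X := by
  have hφ' : ∀ k ∈ Finset.Icc 1 n, ContDiffOn 𝕜 ∞ (φ k) X := fun k hk => (hφ k hk).1
  have hprod : ∀ x ∈ X, ∏ k ∈ Finset.Icc 1 n, φ k x ≠ 0 := fun x hx =>
    Finset.prod_ne_zero_iff.2 fun k hk => (hφ k hk).2 x hx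
  have hsm := contDiffOn_leznov hX hs hφ
  have hB : ∀ k ≤ n, ∀ x ∈ X, B n (D (leznov n φ) k x) (D (leznov n φ) k x) =
      (1 / (∏ k ∈ Finset.Icc 1 n, φ k x) * ∏ j ∈ Finset.range k, φ (letter n j) x) ^ 2 *
        form n (fun m => frame n φ k m x) (fun m => frame n φ k m x) := by
    intro k hk x hx
    obtain ⟨α, -, hαk, hα⟩ := exists_triangular_combination (M := 2 * n) (K := n) hX
      (P := fun k m x => word n (D (leznov n φ) k x) m) (Q := frame n φ)
      (d := fun j => φ (letter n j)) (e := fun _ _ => 1)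
      (p := fun x => 1 / ∏ k ∈ Finset.Icc 1 n, φ k x)
      (fun a ha => hφ' _ (letter_mem (by omega))) (fun _ _ => contDiffOn_const)
      (contDiffOn_one_div_prod hφ)
      (fun a _ m _ x hx => hasDerivAt_frame hX hs hφ' a m hx)
      (fun k _ m _ x hx => by
        simp only [one_mul]
        exact (hasDerivAt_D hX hsm k (wordIndex n m) hx).const_mul (wordSign n m))
      (fun m hm x _ => by
        rw [← word_leznov hm]
        simp [D, word]) k hk
    rw [B_eq_form, form_congr (fun m hm => hα m hm x hx) (fun m hm => hα m hm x hx),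
      form_combination (by omega), hαk x hx]
    · simp only [one_mul]; ring
    · intro a b hab
      rw [form_frame hX h0 hs hφ' (2 * n - (a + b)) a b (by omega) x hx, if_neg (by omega)]
  refine ⟨hsm, fun i hi x hx => ?_, fun x hx => ?_⟩
  · rw [hB i hi.le x hx, form_frame hX h0 hs hφ' (2 * n - 2 * i) i i (by omega) x hx,
      if_neg (by omega), mul_zero]
  · rw [hB n le_rfl x hx, form_frame hX h0 hs hφ' 0 n n (by omega) x hx, if_pos rfl,
      prod_letter n (fun k => φ k x), one_div, inv_mul_cancel₀ (hprod x hx), ← two_mul, pow_mul]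
    simp

end Leznov

/-! ### A triangular square root -/

section SquareRoot

open Polynomial in
/-- The binomial series of `√X` at `1`, truncated. -/
theorem exists_sqrt_polynomial (N : ℕ) : ∃ q : ℂ[X], q.eval 1 = 1 ∧ (X - C 1) ^ N ∣ q ^ 2 - X := by
  induction N with
  | zero => exact ⟨1, by simp, by simp⟩
  | succ N ih =>
    obtain ⟨q, hq1, g, hg⟩ := ih
    rcases Nat.eq_zero_or_pos N with rfl | hN
    · exact ⟨1, by simp, by rw [zero_add, pow_one, dvd_iff_isRoot]; simp⟩
    refine ⟨q - C (g.eval 1 / 2) * (X - C 1) ^ N, by simp [hq1, hN.ne'], ?_⟩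
    have hr : (X - C 1 : ℂ[X]) ∣
        g - C (g.eval 1) * q + C (g.eval 1 / 2) ^ 2 * (X - C 1) ^ N := by
      rw [dvd_iff_isRoot]
      simp [hq1, hN.ne']
    obtain ⟨r, hr⟩ := hr
    refine ⟨r, ?_⟩
    have hc : (C (g.eval 1) : ℂ[X]) = 2 * C (g.eval 1 / 2) := by
      rw [← C_ofNat, ← C_mul]
      congr 1
      ring
    rw [hc] at hr
    linear_combination hg + (X - C 1) ^ N * hr

/-- The Gram matrix of `form`. -/
def antidiag (n : ℕ) : Matrix (Fin (2 * n + 1)) (Fin (2 * n + 1)) ℂ :=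
  Matrix.of fun i j => if j = i.rev then (-1) ^ (n + i.val) else 0

theorem neg_one_pow_rev (n : ℕ) (i : Fin (2 * n + 1)) :
    (-1 : ℂ) ^ (n + i.rev.val) = (-1) ^ (n + i.val) := by
  rw [Fin.val_rev, show 2 * n + 1 - (i.val + 1) = 2 * n - i.val by omega,
    neg_one_pow_add_sub (by omega)]

theorem mul_antidiag_apply {n : ℕ} (M : Matrix (Fin (2 * n + 1)) (Fin (2 * n + 1)) ℂ)
    (i j : Fin (2 * n + 1)) : (M * antidiag n) i j = (-1) ^ (n + j.val) * M i j.rev := by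
  rw [Matrix.mul_apply, Finset.sum_eq_single j.rev]
  · rw [antidiag, Matrix.of_apply, if_pos (by simp), neg_one_pow_rev, mul_comm]
  · intro k _ hk
    rw [antidiag, Matrix.of_apply, if_neg, mul_zero]
    rintro rfl
    simp at hk
  · simp

theorem antidiag_transpose (n : ℕ) : (antidiag n).transpose = antidiag n := by
  ext i j
  simp only [Matrix.transpose_apply, antidiag, Matrix.of_apply]
  by_cases h : i = j.rev
  · rw [if_pos h, if_pos (by rw [h, Fin.rev_rev]), h, neg_one_pow_rev]
  · rw [if_neg h, if_neg (by rintro rfl; simp at h)]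

theorem antidiag_mul_self (n : ℕ) : antidiag n * antidiag n = 1 := by
  ext i j
  rw [mul_antidiag_apply, antidiag, Matrix.of_apply, Matrix.one_apply]
  by_cases h : i = j
  · rw [if_pos (by rw [h]), if_pos h, h, ← mul_pow]; simp
  · rw [if_neg (by simpa using fun h' => h h'.symm), if_neg h, mul_zero]

/-- Polynomials in a lower triangular matrix `S` are lower triangular; if `S` is self-adjoint for
the form with matrix `J`, so are they. -/
theorem aeval_triangular {N : ℕ} {S J : Matrix (Fin N) (Fin N) ℂ} (hS : ∀ i j, i < j → S i j = 0)
    (hJ : S * J = J * S.transpose) (q : Polynomial ℂ) :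
    (∀ i j, i < j → Polynomial.aeval S q i j = 0) ∧
      Polynomial.aeval S q * J = J * (Polynomial.aeval S q).transpose := by
  induction q using Polynomial.induction_on' with
  | add p q hp hq =>
    rw [map_add, Matrix.transpose_add, add_mul, mul_add, hp.2, hq.2]
    exact ⟨fun i j hij => by rw [Matrix.add_apply, hp.1 i j hij, hq.1 i j hij, add_zero], rfl⟩
  | monomial k c =>
    have hpow : (∀ i j, i < j → (S ^ k) i j = 0) ∧ S ^ k * J = J * (S ^ k).transpose := by
      induction k with
      | zero =>
        refine ⟨fun i j hij => ?_, by simp⟩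
        rw [pow_zero, Matrix.one_apply_ne hij.ne]
      | succ k ih =>
        refine ⟨fun i j hij => ?_, ?_⟩
        · rw [pow_succ, Matrix.mul_apply]
          refine Finset.sum_eq_zero fun m _ => ?_
          rcases lt_or_ge i m with h | h
          · rw [ih.1 i m h, zero_mul]
          · rw [hS m j (h.trans_lt hij), mul_zero]
        · rw [pow_succ, mul_assoc, hJ, ← mul_assoc, ih.2, ← pow_succ, pow_succ',
            Matrix.transpose_mul, mul_assoc]
    rw [Polynomial.aeval_monomial, ← Algebra.smul_def]
    refine ⟨fun i j hij => ?_, ?_⟩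
    · rw [Matrix.smul_apply, hpow.1 i j hij, smul_zero]
    · rw [Matrix.transpose_smul, Matrix.smul_mul, Matrix.mul_smul, hpow.2]

/-- A symmetric antitriangular matrix `H` with the antidiagonal of `J = antidiag n` factors as
`T J Tᵀ` with `T` lower triangular. With `S = HJ`, which is unitriangular and self-adjoint for `J`,
one takes `T = √S`, a polynomial in `S`. -/
theorem exists_triangular_factor {n : ℕ} {H : Matrix (Fin (2 * n + 1)) (Fin (2 * n + 1)) ℂ}
    (hsymm : H.transpose = H) (h0 : ∀ i j : Fin (2 * n + 1), i.val + j.val < 2 * n → H i j = 0)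
    (h1 : ∀ i j : Fin (2 * n + 1), i.val + j.val = 2 * n → H i j = (-1) ^ (n + i.val))
    (c : Fin (2 * n + 1)) :
    ∃ T : Matrix (Fin (2 * n + 1)) (Fin (2 * n + 1)) ℂ, (∀ i j, i < j → T i j = 0) ∧
      (∀ i, T i i ≠ 0) ∧ T c c = 1 ∧ T * antidiag n * T.transpose = H := by
  set S := H * antidiag n with hSdef
  have hSJ : S * antidiag n = H := by rw [hSdef, mul_assoc, antidiag_mul_self, mul_one]
  have hlow : ∀ i j, i < j → S i j = 0 := by
    intro i j hij
    have hij' : i.val < j.val := hij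
    rw [hSdef, mul_antidiag_apply, h0, mul_zero]
    rw [Fin.val_rev]; omega
  have hdiag : ∀ i, S i i = 1 := by
    intro i
    rw [hSdef, mul_antidiag_apply, h1 i i.rev (by rw [Fin.val_rev]; omega), ← mul_pow]
    simp
  have hadj : S * antidiag n = antidiag n * S.transpose := by
    rw [hSJ, hSdef, Matrix.transpose_mul, antidiag_transpose, hsymm, ← mul_assoc,
      antidiag_mul_self, one_mul]
  obtain ⟨q, -, g, hg⟩ := exists_sqrt_polynomial (2 * n + 1)
  obtain ⟨hT, hTJ⟩ := aeval_triangular hlow hadj q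
  set T := Polynomial.aeval S q with hTdef
  have hnil : (S - 1) ^ (2 * n + 1) = 0 := by
    have hch : S.charpoly = (Polynomial.X - Polynomial.C 1) ^ (2 * n + 1) := by
      rw [← Matrix.charpoly_transpose, Matrix.charpoly_of_isUpperTriangular]
      · simp [hdiag]
      · intro i j hij
        exact hlow j i hij
    have := Matrix.aeval_self_charpoly S
    rw [hch] at this
    simpa using this
  have hTT : T * T = S := by
    have := congrArg (Polynomial.aeval S) hg
    simp only [map_sub, map_pow, map_mul, Polynomial.aeval_X, map_one, hnil, zero_mul] at this
    rw [← sq]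
    exact sub_eq_zero.1 this
  have hTd : ∀ i, T i i * T i i = 1 := by
    intro i
    rw [← hdiag i, ← hTT, Matrix.mul_apply, Finset.sum_eq_single i]
    · intro m _ hm
      rcases lt_or_gt_of_ne hm with h | h
      · rw [hT m i h, mul_zero]
      · rw [hT i m h, zero_mul]
    · simp
  have hTH : T * antidiag n * T.transpose = H := by
    rw [mul_assoc, ← hTJ, ← mul_assoc, hTT, hSJ]
  have hTne : ∀ i, T i i ≠ 0 := fun i h => by simpa [h] using hTd i
  rcases mul_self_eq_one_iff.1 (hTd c) with h | h
  · exact ⟨T, hT, hTne, h, hTH⟩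
  · refine ⟨-T, fun i j hij => by simp [hT i j hij], fun i => by simpa using hTne i, by simp [h], ?_⟩
    simpa using hTH

theorem word_ext {n : ℕ} {v w : Fin (2 * n + 1) → ℂ} (h : ∀ m ≤ 2 * n, word n v m = word n w m) :
    v = w := by
  funext i
  have hm : (wordIndex n i.val).val ≤ 2 * n := by have := (wordIndex n i.val).isLt; omega
  have h1 := h _ hm
  rw [word, word, wordIndex_wordIndex] at h1
  linear_combination wordSign n (wordIndex n i.val).val * h1 -
    (v i - w i) * wordSign_mul_self n (wordIndex n i.val).val

theorem word_transform_mul {n : ℕ} (v : Fin (2 * n + 1) → ℂ) (m : Fin (2 * n + 1)) :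
    word n (fun i => wordSign n i.val * v (wordIndex n i.val)) m.val = v m := by
  rw [word, wordSign_wordIndex, wordIndex_wordIndex, ← mul_assoc, wordSign_mul_self, one_mul]

theorem B_eq_mul (n : ℕ) (M : Matrix (Fin (2 * n + 1)) (Fin (2 * n + 1)) ℂ)
    (i j : Fin (2 * n + 1)) : B n (M i) (M j) = (M * Theta n * M.transpose) i j := by
  rw [Matrix.mul_assoc, Matrix.mul_apply]
  rfl

theorem B_vecMul {n : ℕ} {A : Matrix (Fin (2 * n + 1)) (Fin (2 * n + 1)) ℂ}
    (hA : A * Theta n * A.transpose = Theta n) (v w : Fin (2 * n + 1) → ℂ) :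
    B n (Matrix.vecMul v A) (Matrix.vecMul w A) = B n v w := by
  rw [B, B, ← Matrix.dotProduct_mulVec, Matrix.mulVec_mulVec, ← Matrix.mulVec_transpose,
    Matrix.mulVec_mulVec, hA]

variable {𝕜 : Type*} [RCLike 𝕜] [NormedAlgebra 𝕜 ℂ]

/-- An orthogonal matrix makes the Wronskian matrix at a point lower triangular in the coordinates
`word`. -/
theorem IsBVector.exists_orthogonal {n : ℕ} {F : Fin (2 * n + 1) → 𝕜 → ℂ} {X : Set 𝕜}
    (hX : IsOpen X) (hF : IsBVector n F X) {x : 𝕜} (hx : x ∈ X) :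
    ∃ A : Matrix (Fin (2 * n + 1)) (Fin (2 * n + 1)) ℂ,
      A.transpose * Theta n * A = Theta n ∧ A * Theta n * A.transpose = Theta n ∧
      (∀ j m, j < m → m ≤ 2 * n → word n (Matrix.vecMul (D F j x) A) m = 0) ∧
      (∀ j ≤ 2 * n, word n (Matrix.vecMul (D F j x) A) j ≠ 0) ∧
      word n (Matrix.vecMul (D F n x) A) n = 1 := by
  obtain ⟨g0, g1⟩ := hF.gram hX
  set W := wronskian F x with hW
  have hdet : IsUnit W.det := by
    rw [isUnit_iff_ne_zero]
    intro h0
    have h := hF.det_gram hX hx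
    rw [← hW, h0, mul_zero] at h
    have := signProd_mul_self n (2 * n + 1)
    rw [← h] at this
    simp at this
  obtain ⟨T, hT0, hTne, hTn, hTH⟩ := exists_triangular_factor (n := n)
    (H := W * Theta n * W.transpose)
    (by rw [Matrix.transpose_mul, Matrix.transpose_mul, Matrix.transpose_transpose,
      Theta_transpose, mul_assoc])
    (fun i j h => by rw [← B_eq_mul]; exact g0 i j h x hx)
    (fun i j h => by rw [← B_eq_mul]; exact g1 i j h x hx) ⟨n, by omega⟩
  let T' : Matrix (Fin (2 * n + 1)) (Fin (2 * n + 1)) ℂ :=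
    Matrix.of fun j i => wordSign n i.val * T j (wordIndex n i.val)
  have hT' : T' * Theta n * T'.transpose = W * Theta n * W.transpose := by
    rw [← hTH]
    ext j k
    rw [← B_eq_mul, B_eq_form, form, Finset.sum_range, Matrix.mul_apply]
    refine (Fintype.sum_equiv Fin.revPerm _ _ fun m => ?_)
    have hr : 2 * n - m.val = m.rev.val := by rw [Fin.val_rev]; omega
    rw [hr]
    change _ * (word n (fun i => wordSign n i.val * T j (wordIndex n i.val)) m.val *
      word n (fun i => wordSign n i.val * T k (wordIndex n i.val)) m.rev.val) = _
    rw [word_transform_mul, word_transform_mul, Fin.revPerm_apply, mul_antidiag_apply,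
      Matrix.transpose_apply, neg_one_pow_rev, Fin.rev_rev, mul_assoc]
  have hWA : W * (W⁻¹ * T') = T' := Matrix.mul_nonsing_inv_cancel_left _ _ hdet
  have hA : (W⁻¹ * T') * Theta n * (W⁻¹ * T').transpose = Theta n := by
    have h1 : (W⁻¹ * T') * Theta n * (W⁻¹ * T').transpose =
        W⁻¹ * (T' * Theta n * T'.transpose) * W⁻¹.transpose := by
      rw [Matrix.transpose_mul]; simp only [mul_assoc]
    have h2 : W.transpose * W⁻¹.transpose = 1 := by
      rw [← Matrix.transpose_mul, Matrix.nonsing_inv_mul _ hdet, Matrix.transpose_one]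
    rw [h1, hT', mul_assoc, mul_assoc, mul_assoc, h2, mul_one, ← mul_assoc,
      Matrix.nonsing_inv_mul _ hdet, one_mul]
  have hrow : ∀ j m : Fin (2 * n + 1),
      word n (Matrix.vecMul (D F j.val x) (W⁻¹ * T')) m.val = T j m := by
    intro j m
    have h1 : Matrix.vecMul (D F j.val x) (W⁻¹ * T') = (W * (W⁻¹ * T')) j := rfl
    rw [h1, hWA]
    exact word_transform_mul _ m
  refine ⟨W⁻¹ * T', ?_, hA, fun j m hjm hm => ?_, fun j hj => ?_, ?_⟩
  · have h1 : (W⁻¹ * T') * (Theta n * (W⁻¹ * T').transpose * Theta n) = 1 := by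
      rw [← mul_assoc, ← mul_assoc, hA, Theta_mul_self]
    have h2 := congrArg (fun M => Theta n * M) (mul_eq_one_comm.1 h1)
    simp only [← mul_assoc, Theta_mul_self, one_mul, mul_one] at h2
    simpa only [mul_assoc] using h2
  · rw [hrow ⟨j, by omega⟩ ⟨m, by omega⟩]
    exact hT0 _ _ hjm
  · rw [hrow ⟨j, by omega⟩ ⟨j, by omega⟩]
    exact hTne _
  · rw [hrow ⟨n, by omega⟩ ⟨n, by omega⟩]
    exact hTn

theorem D_vecMul {m : ℕ} {F : Fin m → 𝕜 → ℂ} {X : Set 𝕜} (hX : IsOpen X)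
    (hF : ∀ k, ContDiffOn 𝕜 ∞ (F k) X) (A : Matrix (Fin m) (Fin m) ℂ) (j : ℕ) :
    ∀ x ∈ X, D (fun k x => Matrix.vecMul (fun i => F i x) A k) j x =
      Matrix.vecMul (D F j x) A := by
  induction j with
  | zero =>
    intro x _
    have h0 : D F 0 x = fun i => F i x := by funext i; simp [D]
    funext k
    simp [h0, D]
  | succ j ih =>
    intro x hx
    funext k
    have h1 : HasDerivAt (fun x => Matrix.vecMul (D F j x) A k)
        (Matrix.vecMul (D F (j + 1) x) A k) x := by
      simp only [Matrix.vecMul, dotProduct]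
      exact HasDerivAt.fun_sum fun a _ => (hasDerivAt_D hX hF j a hx).mul_const _
    change iteratedDeriv (j + 1) _ x = _
    rw [iteratedDeriv_succ, ← h1.deriv]
    refine Filter.EventuallyEq.deriv_eq ?_
    filter_upwards [hX.mem_nhds hx] with z hz
    exact congrFun (ih z hz) k

theorem IsBVector.vecMul {n : ℕ} {F : Fin (2 * n + 1) → 𝕜 → ℂ} {X : Set 𝕜} (hX : IsOpen X)
    (hF : IsBVector n F X) {A : Matrix (Fin (2 * n + 1)) (Fin (2 * n + 1)) ℂ}
    (hA : A * Theta n * A.transpose = Theta n) :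
    IsBVector n (fun k x => Matrix.vecMul (fun i => F i x) A k) X := by
  refine ⟨fun k => ?_, fun i hi x hx => ?_, fun x hx => ?_⟩
  · simp only [Matrix.vecMul, dotProduct]
    exact ContDiffOn.sum fun a _ => (hF.smooth a).mul contDiffOn_const
  · rw [D_vecMul hX hF.smooth A i x hx, B_vecMul hA, hF.null i hi x hx]
  · rw [D_vecMul hX hF.smooth A n x hx, B_vecMul hA, hF.unit x hx]

end SquareRoot

/-! ### Every `Bₙ`-vector is Leznov's, up to an orthogonal matrix -/

section Reduction

variable {𝕜 : Type*} [RCLike 𝕜] [NormedAlgebra 𝕜 ℂ]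

/-- The vectors `u₀ = E` and `u_{k+1} = (u_k / u_{k,k})'`. -/
def reduced (E : ℕ → 𝕜 → ℂ) : ℕ → ℕ → 𝕜 → ℂ
  | 0 => E
  | k + 1 => fun m => deriv fun x => (reduced E k k x)⁻¹ * reduced E k m x

theorem contDiffOn_reduced {U : Set 𝕜} (hU : IsOpen U) {E : ℕ → 𝕜 → ℂ}
    (hE : ∀ m, ContDiffOn 𝕜 ∞ (E m) U) {K : ℕ} (hne : ∀ j < K, ∀ x ∈ U, reduced E j j x ≠ 0)
    (k : ℕ) (hk : k ≤ K) (m : ℕ) : ContDiffOn 𝕜 ∞ (reduced E k m) U := by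
  induction k generalizing m with
  | zero => exact hE m
  | succ k ih =>
    exact contDiffOn_deriv hU (((ih (by omega) k).inv (hne k hk)).mul (ih (by omega) m))

theorem hasDerivAt_reduced {U : Set 𝕜} (hU : IsOpen U) {E : ℕ → 𝕜 → ℂ}
    (hE : ∀ m, ContDiffOn 𝕜 ∞ (E m) U) {K : ℕ} (hne : ∀ j < K, ∀ x ∈ U, reduced E j j x ≠ 0)
    {k : ℕ} (hk : k < K) (m : ℕ) {x : 𝕜} (hx : x ∈ U) :
    HasDerivAt (fun x => (reduced E k k x)⁻¹ * reduced E k m x) (reduced E (k + 1) m x) x :=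
  (differentiableAt_of_contDiffOn hU (((contDiffOn_reduced hU hE hne k hk.le k).inv
    (hne k hk)).mul (contDiffOn_reduced hU hE hne k hk.le m)) hx).hasDerivAt

theorem reduced_of_lt {U : Set 𝕜} (hU : IsOpen U) {E : ℕ → 𝕜 → ℂ} {K : ℕ}
    (hne : ∀ j < K, ∀ x ∈ U, reduced E j j x ≠ 0) (k : ℕ) (hk : k ≤ K) (m : ℕ) (hm : m < k) :
    ∀ x ∈ U, reduced E k m x = 0 := by
  induction k generalizing m with
  | zero => omega
  | succ k ih =>
    intro x hx
    have hconst : ∃ c : ℂ, (fun x => (reduced E k k x)⁻¹ * reduced E k m x) =ᶠ[𝓝 x] fun _ => c := by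
      rcases Nat.lt_or_eq_of_le (Nat.lt_succ_iff.1 hm) with h | rfl
      · refine ⟨0, ?_⟩
        filter_upwards [hU.mem_nhds hx] with z hz
        rw [ih (by omega) m h z hz, mul_zero]
      · refine ⟨1, ?_⟩
        filter_upwards [hU.mem_nhds hx] with z hz
        exact inv_mul_cancel₀ (hne m (by omega) z hz)
    obtain ⟨c, hc⟩ := hconst
    change deriv _ x = 0
    rw [hc.deriv_eq, deriv_const]

/-- The coordinates `word` of `F`. -/
def wordFun (n : ℕ) (F : Fin (2 * n + 1) → 𝕜 → ℂ) (m : ℕ) (x : 𝕜) : ℂ :=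
  word n (fun i => F i x) m

theorem contDiffOn_wordFun {n : ℕ} {F : Fin (2 * n + 1) → 𝕜 → ℂ} {U : Set 𝕜}
    (hF : ∀ k, ContDiffOn 𝕜 ∞ (F k) U) (m : ℕ) : ContDiffOn 𝕜 ∞ (wordFun n F m) U :=
  contDiffOn_const.mul (hF _)

theorem reduced_eq_sum {n : ℕ} {F : Fin (2 * n + 1) → 𝕜 → ℂ} {U : Set 𝕜} (hU : IsOpen U)
    (hF : ∀ k, ContDiffOn 𝕜 ∞ (F k) U) {K : ℕ}
    (hne : ∀ j < K, ∀ x ∈ U, reduced (wordFun n F) j j x ≠ 0) (k : ℕ) (hk : k ≤ K) :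
    ∃ α : ℕ → 𝕜 → ℂ,
      (∀ x ∈ U, α k x = ∏ j ∈ Finset.range k, (reduced (wordFun n F) j j x)⁻¹) ∧
      ∀ m ≤ 2 * n, ∀ x ∈ U, reduced (wordFun n F) k m x =
        ∑ a ∈ Finset.range (k + 1), α a x * word n (D F a x) m := by
  have hE := contDiffOn_wordFun hF
  obtain ⟨α, -, hαk, hα⟩ := exists_triangular_combination (M := 2 * n) (K := K) hU
    (P := reduced (wordFun n F)) (Q := fun k m x => word n (D F k x) m)
    (d := fun _ _ => 1) (e := fun k x => (reduced (wordFun n F) k k x)⁻¹) (p := fun _ => 1)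
    (fun _ _ => contDiffOn_const)
    (fun a ha => (contDiffOn_reduced hU hE hne a ha.le a).inv (hne a ha)) contDiffOn_const
    (fun a _ m _ x hx => by
      simp only [one_mul]
      exact (hasDerivAt_D hU hF a (wordIndex n m) hx).const_mul (wordSign n m))
    (fun k hk m _ x hx => hasDerivAt_reduced hU hE hne hk m hx)
    (fun m _ x _ => by simp [reduced, wordFun, word, D]) k hk
  exact ⟨α, fun x hx => by simpa using hαk x hx, hα⟩

/-- If the Wronskian matrix of `F` at `0` is lower triangular, then so is the matrix of the vectors
`u_k`, and the diagonals are proportional. -/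
theorem reduced_at_zero {n : ℕ} {F : Fin (2 * n + 1) → 𝕜 → ℂ} {U : Set 𝕜} (hU : IsOpen U)
    (h0 : (0 : 𝕜) ∈ U) (hF : ∀ k, ContDiffOn 𝕜 ∞ (F k) U)
    (hlow : ∀ j m, j < m → m ≤ 2 * n → word n (D F j 0) m = 0) {K : ℕ}
    (hne : ∀ j < K, ∀ x ∈ U, reduced (wordFun n F) j j x ≠ 0) {k : ℕ} (hk : k ≤ K) :
    (∀ m, k < m → m ≤ 2 * n → reduced (wordFun n F) k m 0 = 0) ∧
      (k ≤ 2 * n → reduced (wordFun n F) k k 0 =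
        (∏ j ∈ Finset.range k, (reduced (wordFun n F) j j 0)⁻¹) * word n (D F k 0) k) := by
  obtain ⟨α, hαk, hα⟩ := reduced_eq_sum hU hF hne k hk
  refine ⟨fun m hkm hm => ?_, fun hkn => ?_⟩
  · rw [hα m hm 0 h0]
    refine Finset.sum_eq_zero fun a ha => ?_
    have := Finset.mem_range.1 ha
    rw [hlow a m (by omega) hm, mul_zero]
  · rw [hα k hkn 0 h0, Finset.sum_range_succ, hαk 0 h0, Finset.sum_eq_zero, zero_add]
    intro a ha
    rw [hlow a k (Finset.mem_range.1 ha) hkn, mul_zero]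

theorem exists_ball_reduced_ne_zero {n : ℕ} {F : Fin (2 * n + 1) → 𝕜 → ℂ} {X : Set 𝕜}
    (hX : IsOpen X) (h0 : (0 : 𝕜) ∈ X) (hF : ∀ k, ContDiffOn 𝕜 ∞ (F k) X)
    (hlow : ∀ j m, j < m → m ≤ 2 * n → word n (D F j 0) m = 0)
    (hdiag : ∀ j ≤ 2 * n, word n (D F j 0) j ≠ 0) (K : ℕ) (hK : K ≤ 2 * n + 1) :
    ∃ δ > 0, Metric.ball (0 : 𝕜) δ ⊆ X ∧
      ∀ j < K, ∀ x ∈ Metric.ball (0 : 𝕜) δ, reduced (wordFun n F) j j x ≠ 0 := by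
  induction K with
  | zero =>
    obtain ⟨δ, hδ, hb⟩ := Metric.isOpen_iff.1 hX 0 h0
    exact ⟨δ, hδ, hb, by simp⟩
  | succ K ih =>
    obtain ⟨δ, hδ, hb, hne⟩ := ih (by omega)
    have h0' : (0 : 𝕜) ∈ Metric.ball (0 : 𝕜) δ := Metric.mem_ball_self hδ
    have hFb : ∀ k, ContDiffOn 𝕜 ∞ (F k) (Metric.ball 0 δ) := fun k => (hF k).mono hb
    have hKne : reduced (wordFun n F) K K 0 ≠ 0 := by
      rw [(reduced_at_zero Metric.isOpen_ball h0' hFb hlow hne le_rfl).2 (by omega)]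
      exact mul_ne_zero (Finset.prod_ne_zero_iff.2 fun j hj =>
        inv_ne_zero (hne j (Finset.mem_range.1 hj) 0 h0')) (hdiag K (by omega))
    have hcont : ContinuousAt (reduced (wordFun n F) K K) 0 :=
      (contDiffOn_reduced Metric.isOpen_ball (contDiffOn_wordFun hFb) hne K le_rfl
        K).continuousOn.continuousAt (Metric.isOpen_ball.mem_nhds h0')
    obtain ⟨δ', hδ', hb'⟩ := Metric.eventually_nhds_iff_ball.1 (hcont.eventually_ne hKne)
    refine ⟨min δ δ', lt_min hδ hδ', (Metric.ball_subset_ball (min_le_left _ _)).trans hb,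
      fun j hj x hx => ?_⟩
    rcases Nat.lt_or_eq_of_le (Nat.lt_succ_iff.1 hj) with h | rfl
    · exact hne j h x (Metric.ball_subset_ball (min_le_left _ _) hx)
    · exact hb' x (Metric.ball_subset_ball (min_le_right _ _) hx)

/-- A `Bₙ`-vector whose Wronskian matrix at `0` is lower triangular is Leznov's vector for the
functions `φ_k = u_{k,k}`, `1 ≤ k ≤ n`. Antitriangularity of the Gram matrix makes
`u_{1,1}, …, u_{2n,2n}` a palindrome and `u_{0,0} ⋯ u_{n,n} = 1`. -/
theorem IsBVector.exists_leznov {n : ℕ} {F : Fin (2 * n + 1) → 𝕜 → ℂ} {X : Set 𝕜}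
    (hX : IsOpen X) (h0 : (0 : 𝕜) ∈ X) (hF : IsBVector n F X)
    (hlow : ∀ j m, j < m → m ≤ 2 * n → word n (D F j 0) m = 0)
    (hdiag : ∀ j ≤ 2 * n, word n (D F j 0) j ≠ 0) (hone : word n (D F n 0) n = 1) :
    ∃ U : Set 𝕜, IsOpen U ∧ (0 : 𝕜) ∈ U ∧ StarConvex ℝ (0 : 𝕜) U ∧ U ⊆ X ∧
      ∃ φ : ℕ → 𝕜 → ℂ, (∀ k ∈ Finset.Icc 1 n, ContDiffOn 𝕜 ∞ (φ k) U ∧ ∀ x ∈ U, φ k x ≠ 0) ∧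
        ∀ x ∈ U, (fun k => F k x) = fun k => leznov n φ k x := by
  obtain ⟨δ, hδ, hUX, hne⟩ :=
    exists_ball_reduced_ne_zero hX h0 hF.smooth hlow hdiag (2 * n + 1) le_rfl
  have g0 := (hF.gram hX).1
  set U := Metric.ball (0 : 𝕜) δ with hUdef
  have hU : IsOpen U := Metric.isOpen_ball
  have h0U : (0 : 𝕜) ∈ U := Metric.mem_ball_self hδ
  have hs : StarConvex ℝ (0 : 𝕜) U := (convex_ball (0 : 𝕜) δ).starConvex h0U
  have hFU : ∀ k, ContDiffOn 𝕜 ∞ (F k) U := fun k => (hF.smooth k).mono hUX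
  have hE := contDiffOn_wordFun hFU
  set u := reduced (wordFun n F) with hu
  have hsm : ∀ k ≤ 2 * n, ∀ m, ContDiffOn 𝕜 ∞ (u k m) U := fun k hk m =>
    contDiffOn_reduced hU hE hne k (by omega) m
  have hder : ∀ k ≤ 2 * n, ∀ m, ∀ x ∈ U,
      HasDerivAt (fun x => (u k k x)⁻¹ * u k m x) (u (k + 1) m x) x := fun k hk m x hx =>
    hasDerivAt_reduced hU hE hne (by omega) m hx
  have hlt : ∀ k ≤ 2 * n, ∀ m < k, ∀ x ∈ U, u k m x = 0 := fun k hk m hm =>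
    reduced_of_lt hU hne k (by omega) m hm
  have hne' : ∀ k ≤ 2 * n, ∀ x ∈ U, u k k x ≠ 0 := fun k hk => hne k (by omega)
  have hat0 : ∀ k ≤ 2 * n, (∀ m, k < m → m ≤ 2 * n → u k m 0 = 0) ∧
      (k ≤ 2 * n → u k k 0 = (∏ j ∈ Finset.range k, (u j j 0)⁻¹) * word n (D F k 0) k) :=
    fun k hk => reduced_at_zero hU h0U hFU hlow hne (show k ≤ 2 * n + 1 by omega)
  -- the Gram matrix of the `u_k`, from their expression through the derivatives of `F`
  have hgram : ∀ k l, k + l ≤ 2 * n → ∀ x ∈ U,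
      form n (fun m => u k m x) (fun m => u l m x) =
        (∏ j ∈ Finset.range k, (u j j x)⁻¹) * (∏ j ∈ Finset.range l, (u j j x)⁻¹) *
          B n (D F k x) (D F l x) := by
    intro k l hkl x hx
    obtain ⟨α, hαk, hα⟩ := reduced_eq_sum hU hFU hne k (by omega)
    obtain ⟨β, hβl, hβ⟩ := reduced_eq_sum hU hFU hne l (by omega)
    rw [form_congr (fun m hm => hα m hm x hx) (fun m hm => hβ m hm x hx),
      form_combination (v := fun a => word n (D F a x)) hkl, hαk x hx, hβl x hx, ← B_eq_form]
    intro a b hab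
    rw [← B_eq_form]
    exact g0 a b hab x (hUX hx)
  -- the same products, from the vanishing coordinates
  have hgram' : ∀ k l, k + l = 2 * n → ∀ x ∈ U,
      form n (fun m => u k m x) (fun m => u l m x) = (-1) ^ (n + k) * (u k k x * u l l x) :=
    fun k l hkl x hx => form_of_triangular hkl (fun m hm => hlt k (by omega) m hm x hx)
      (fun m hm => hlt l (by omega) m hm x hx)
  have hprod : ∀ x ∈ U, ∏ j ∈ Finset.range (n + 1), u j j x = 1 := by
    have hpc : ContinuousOn (fun x => ∏ j ∈ Finset.range (n + 1), u j j x) U :=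
      continuousOn_finsetProd _ fun j hj =>
        (hsm j (by have := Finset.mem_range.1 hj; omega) j).continuousOn
    have hat : ∏ j ∈ Finset.range (n + 1), u j j 0 = 1 := by
      rw [Finset.prod_range_succ, (hat0 n (by omega)).2 (by omega), hone, mul_one,
        ← Finset.prod_mul_distrib]
      exact Finset.prod_eq_one fun j hj => mul_inv_cancel₀
        (hne' j (by have := Finset.mem_range.1 hj; omega) 0 h0U)
    refine (isPreconnected_of_starConvex hs).eq_of_sq_eq (g := fun _ => 1) hpc
      continuousOn_const (fun x hx => ?_) (fun _ => one_ne_zero) h0U hat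
    have h1 := hgram n n (by omega) x hx
    rw [hgram' n n (by omega) x hx, hF.unit x (hUX hx), ← two_mul, pow_mul, neg_one_sq,
      one_pow, one_mul, mul_one] at h1
    have h2 : (∏ j ∈ Finset.range n, u j j x) * ∏ j ∈ Finset.range n, (u j j x)⁻¹ = 1 := by
      rw [← Finset.prod_mul_distrib]
      exact Finset.prod_eq_one fun j hj => mul_inv_cancel₀
        (hne' j (by have := Finset.mem_range.1 hj; omega) x hx)
    simp only [Pi.pow_apply, one_pow]
    rw [Finset.prod_range_succ]
    linear_combination (∏ j ∈ Finset.range n, u j j x) ^ 2 * h1 +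
      ((∏ j ∈ Finset.range n, u j j x) * (∏ j ∈ Finset.range n, (u j j x)⁻¹) + 1) * h2
  have hpal : ∀ k l, k + l + 1 = 2 * n → ∀ x ∈ U, u (k + 1) (k + 1) x = u (l + 1) (l + 1) x := by
    intro k l hkl x hx
    have hd1 := hasDerivAt_form n (fun m _ => hder k (by omega) m x hx)
      (fun m _ => hder l (by omega) m x hx)
    have hd2 : HasDerivAt (fun x => form n (fun m => (u k k x)⁻¹ * u k m x)
        (fun m => (u l l x)⁻¹ * u l m x)) 0 x := by
      refine (hasDerivAt_const x (0 : ℂ)).congr_of_eventuallyEq ?_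
      filter_upwards [hU.mem_nhds hx] with z hz
      rw [form_mul_left, form_mul_right, hgram k l (by omega) z hz, g0 k l (by omega) z (hUX hz)]
      simp
    have h1 := hd1.unique hd2
    rw [form_mul_left, form_mul_right, hgram' (k + 1) l (by omega) x hx,
      hgram' k (l + 1) (by omega) x hx] at h1
    have hk := mul_inv_cancel₀ (hne' k (by omega) x hx)
    have hl := mul_inv_cancel₀ (hne' l (by omega) x hx)
    have hsgn : (-1 : ℂ) ^ (n + k) * (-1) ^ (n + k) = 1 := by rw [← mul_pow]; simp
    have h2 : (-1 : ℂ) ^ (n + k) * (u (l + 1) (l + 1) x - u (k + 1) (k + 1) x) = 0 := by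
      rw [show n + (k + 1) = n + k + 1 by omega, pow_succ] at h1
      linear_combination h1 + (-1) ^ (n + k) * (u (k + 1) (k + 1) x * hl -
        u (l + 1) (l + 1) x * hk)
    linear_combination -(-1) ^ (n + k) * h2 +
      (u (l + 1) (l + 1) x - u (k + 1) (k + 1) x) * hsgn
  let φ : ℕ → 𝕜 → ℂ := fun k => u k k
  have hφ : ∀ k ∈ Finset.Icc 1 n, ContDiffOn 𝕜 ∞ (φ k) U ∧ ∀ x ∈ U, φ k x ≠ 0 := fun k hk => by
    have := Finset.mem_Icc.1 hk
    exact ⟨hsm k (by omega) k, hne' k (by omega)⟩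
  have hφl : ∀ k < 2 * n, ∀ x ∈ U, φ (letter n k) x = u (k + 1) (k + 1) x := by
    intro k hk x hx
    unfold letter
    split_ifs with h
    · rfl
    · rw [hpal k (2 * n - 1 - k) (by omega) x hx, show 2 * n - 1 - k + 1 = 2 * n - k by omega]
  have hframe : ∀ d k, k + d = 2 * n → ∀ m ≤ 2 * n, ∀ x ∈ U,
      (u k k x)⁻¹ * u k m x = frame n φ k m x := by
    intro d
    induction d with
    | zero =>
      intro k hk m hm x hx
      rcases Nat.lt_or_eq_of_le (show m ≤ k by omega) with h | rfl
      · rw [frame_of_lt φ h, hlt k (by omega) m h x hx, mul_zero]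
      · rw [frame_self φ hm, inv_mul_cancel₀ (hne' m hm x hx)]
    | succ d ih =>
      intro k hk m hm x hx
      rcases lt_trichotomy m k with h | rfl | h
      · rw [frame_of_lt φ h, hlt k (by omega) m h x hx, mul_zero]
      · rw [frame_self φ hm, inv_mul_cancel₀ (hne' m hm x hx)]
      · rw [frame_of_gt φ h hm]
        refine eq_primitive hU hs h0U (f := fun x => (u k k x)⁻¹ * u k m x) ?_ (fun z hz => ?_) ?_ hx
        · exact (hφ _ (letter_mem (by omega))).1.mul
            (contDiffOn_frame hU hs (fun a ha => (hφ a ha).1) _ _)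
        · refine (hder k (by omega) m z hz).congr_deriv ?_
          rw [← ih (k + 1) (by omega) m hm z hz, hφl k (by omega) z hz,
            mul_inv_cancel_left₀ (hne' (k + 1) (by omega) z hz)]
        · rw [(hat0 k (by omega)).1 m h hm, mul_zero]
  refine ⟨U, hU, h0U, hs, hUX, φ, hφ, fun x hx => word_ext fun m hm => ?_⟩
  rw [word_leznov hm, ← hframe (2 * n) 0 (by omega) m hm x hx,
    ← prod_letter n fun k => φ k x, ← mul_assoc]
  have h1 := hprod x hx
  rw [Finset.prod_range_succ'] at h1
  have h2 : ∏ j ∈ Finset.range n, φ (letter n j) x =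
      ∏ j ∈ Finset.range n, u (j + 1) (j + 1) x :=
    Finset.prod_congr rfl fun j hj => hφl j (by have := Finset.mem_range.1 hj; omega) x hx
  have h3 : ∏ j ∈ Finset.range n, u (j + 1) (j + 1) x ≠ 0 := left_ne_zero_of_mul_eq_one h1
  have h4 := hne' 0 (by omega) x hx
  have h5 : 1 / (∏ j ∈ Finset.range n, u (j + 1) (j + 1) x) = u 0 0 x := by
    rw [one_div]
    exact inv_eq_of_mul_eq_one_right h1
  rw [h2, h5, mul_inv_cancel₀ h4, one_mul]
  rfl

theorem IsBVector.exists_orthogonal_leznov {n : ℕ} {F : Fin (2 * n + 1) → 𝕜 → ℂ} {X : Set 𝕜}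
    (hX : IsOpen X) (h0 : (0 : 𝕜) ∈ X) (hF : IsBVector n F X) :
    ∃ A : Matrix (Fin (2 * n + 1)) (Fin (2 * n + 1)) ℂ,
      A.transpose * Theta n * A = Theta n ∧
      ∃ U : Set 𝕜, IsOpen U ∧ (0 : 𝕜) ∈ U ∧ StarConvex ℝ (0 : 𝕜) U ∧ U ⊆ X ∧
      ∃ φ : ℕ → 𝕜 → ℂ,
        (∀ k ∈ Finset.Icc 1 n, ContDiffOn 𝕜 ∞ (φ k) U ∧ ∀ x ∈ U, φ k x ≠ 0) ∧
        ∀ x ∈ U, Matrix.vecMul (fun k => F k x) A = fun k => leznov n φ k x := by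
  obtain ⟨A, hA, hA', hlow, hdiag, hone⟩ := hF.exists_orthogonal hX h0
  have hD := fun j => D_vecMul hX hF.smooth A j 0 h0
  refine ⟨A, hA, (hF.vecMul hX hA').exists_leznov hX h0 (fun j m hjm hm => ?_) (fun j hj => ?_) ?_⟩
  · rw [hD]; exact hlow j m hjm hm
  · rw [hD]; exact hdiag j hj
  · rw [hD]; exact hone

end Reduction

end BnToda

end

open scoped ContDiff in
theorem theorem3 {𝕜 : Type*} [RCLike 𝕜] [NormedAlgebra 𝕜 ℂ] (n : ℕ) (hn : 2 ≤ n) :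
    -- (1) the Toda system
    (∀ (X Y : Set 𝕜), IsOpen X → IsPreconnected X → IsOpen Y → IsPreconnected Y →
      ∀ F G : Fin (2 * n + 1) → 𝕜 → ℂ, BnToda.IsBVector n F X → BnToda.IsBVector n G Y →
        ∃ ε : ℂ, (ε = 1 ∨ ε = -1) ∧
          ∀ S : Set (𝕜 × 𝕜), IsOpen S → S ⊆ X ×ˢ Y →
            ∀ l : Fin n → 𝕜 × 𝕜 → ℂ,
              (∀ i, BnToda.IsLogBranch (BnToda.tau F G (i.val + 1)) (l i) S) →
              BnToda.IsTodaSolution n (ε / 2)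
                (fun i p => if i.val + 1 = n then -(1 / 2) * l i p else -l i p) S) ∧
    -- (2) Leznov's vectors satisfy the conditions
    (∀ X : Set 𝕜, IsOpen X → (0 : 𝕜) ∈ X → StarConvex ℝ (0 : 𝕜) X →
      ∀ φ : ℕ → 𝕜 → ℂ,
        (∀ k ∈ Finset.Icc 1 n, ContDiffOn 𝕜 ∞ (φ k) X ∧ ∀ x ∈ X, φ k x ≠ 0) →
        BnToda.IsBVector n (BnToda.leznov n φ) X) ∧
    -- (2) and they are the most general solution, up to a constant orthogonal matrix
    (∀ X : Set 𝕜, IsOpen X → (0 : 𝕜) ∈ X →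
      ∀ F : Fin (2 * n + 1) → 𝕜 → ℂ, BnToda.IsBVector n F X →
        ∃ A : Matrix (Fin (2 * n + 1)) (Fin (2 * n + 1)) ℂ,
          A.transpose * BnToda.Theta n * A = BnToda.Theta n ∧
          ∃ U : Set 𝕜, IsOpen U ∧ (0 : 𝕜) ∈ U ∧ StarConvex ℝ (0 : 𝕜) U ∧ U ⊆ X ∧
          ∃ φ : ℕ → 𝕜 → ℂ,
            (∀ k ∈ Finset.Icc 1 n, ContDiffOn 𝕜 ∞ (φ k) U ∧ ∀ x ∈ U, φ k x ≠ 0) ∧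
            ∀ x ∈ U, Matrix.vecMul (fun k => F k x) A = fun k => BnToda.leznov n φ k x) := by
  refine ⟨fun X Y hX hXc hY hYc F G hF hG => ?_, fun X hX h0 hs φ hφ => ?_,
    fun X hX h0 F hF => ?_⟩
  · obtain ⟨ε, hε, h⟩ := BnToda.exists_sign hX hXc hY hYc hF hG
    exact ⟨ε, hε, fun S hS hSXY l hl =>
      BnToda.isTodaSolution_of_sign hX hY hF.smooth hG.smooth h hS hSXY hl⟩
  · exact BnToda.isBVector_leznov hX h0 hs hφ
  · exact hF.exists_orthogonal_leznov hX h0
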